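/- Let $n\ge 1$ be an integer, $s>5/2$, and let $u_0\in H^s(\mathbb R)$ be real-valued with $m_0:=u_0-u_0''\ge 0$ on $\mathbb R$. Let $T>0$ and let $u\in C([0,T);H^s(\mathbb R))\cap C^1([0,T);H^{s-1}(\mathbb R))$ be a strong solution with initial data $u(0,\cdot)=u_0$ of the generalized higher-order Camassa--Holm equation $$m_t+(u^2-u_x^2)^{n-1}u_x\,m+\partial_x\big[(u^2-u_x^2)^{n-1}u\,m\big]=0,\qquad m=u-u_{xx},$$ where the equation holds in the sense of distributions in $x$ for every $t\in[0,T)$ and each $u(t,\cdot)$ is identified with its continuous representative. Put $$H_1(u)=\int_{\mathbb R}(u^2+u_x^2)\,dx,\qquad H_2(u)=\int_{\mathbb R}\Big(u^{2n+1}+\sum_{k=1}^n\frac{(-1)^{k+1}}{2k-1}\binom nk u^{2n-2k+1}u_x^{2k}\Big)dx,$$ $$c_1=\frac12+\sum_{j=1}^n(-1)^{j+1}\frac{2j-3}{2(2j-1)}\binom nj .$$ Then for every $t\in[0,T)$ the maximum $M(t)=\max_{x\in\mathbb R}u(t,x)$ is attained, and $$\frac{(2n-1)(2-c_1)}{2n+1}M(t)^{2n+1}-\frac{2-c_1}{2}M(t)^{2n-1}H_1(u(t,\cdot))+H_2(u(t,\cdot))\le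 0 .$$ -/

import Mathlib

noncomputable section

open MeasureTheory Set TemperedDistribution
open scoped SchwartzMap ContDiff

namespace HOCH

/-- `BesselLift s f F`: the real function `f` lies in `L²(ℝ)` and, as a tempered distribution, its
Bessel potential of order `s` is the `L²` function `F`.  So `f ∈ H^s(ℝ)` if and only if such an `F`
exists; `F` is then unique, `f ↦ F` is linear, and `‖F‖_{L²}` is the norm of `f` in `H^s` (with the
weight `(1 + ξ²)^s`, `ξ` the frequency in Mathlib's normalization; an equivalent norm). -/
def BesselLift (s : ℝ) (f : ℝ → ℝ) (F : Lp ℂ 2 (volume : Measure ℝ)) : Prop :=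
  ∃ hf : MemLp (fun x => (f x : ℂ)) 2 (volume : Measure ℝ),
    besselPotential ℝ ℂ s (hf.toLp : 𝓢'(ℝ, ℂ)) = (F : 𝓢'(ℝ, ℂ))

/-- `f ∈ H^s(ℝ)`, for `s ≥ 0` (functions in `L²` only). -/
def MemHs (s : ℝ) (f : ℝ → ℝ) : Prop :=
  ∃ hf : MemLp (fun x => (f x : ℂ)) 2 (volume : Measure ℝ),
    MemSobolev s 2 (hf.toLp : 𝓢'(ℝ, ℂ))

/-- `u ∈ C^k([0,T); H^s(ℝ))`, where `u t` is the function `u(t, ·)`. The space `H^s` is carried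
isometrically onto `L²` by the Bessel potential, so this is `C^k` regularity of the lifted curve. -/
def CurveInHs (k : ℕ) (T s : ℝ) (u : ℝ → ℝ → ℝ) : Prop :=
  ∃ U : ℝ → Lp ℂ 2 (volume : Measure ℝ),
    ContDiffOn ℝ k U (Ico 0 T) ∧ ∀ t ∈ Ico 0 T, BesselLift s (u t) (U t)

/-- The momentum density `m = f - f_xx`. -/
def momentum (f : ℝ → ℝ) (x : ℝ) : ℝ := f x - deriv (deriv f) x

/-- The factor `(f² - f_x²)^(n-1)`. -/
def factor (n : ℕ) (f : ℝ → ℝ) (x : ℝ) : ℝ := (f x ^ 2 - deriv f x ^ 2) ^ (n - 1)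

/-- `u_t(t, x)` for a function on `[0,T) × ℝ` (one-sided at `t = 0`). -/
def timeDeriv (T : ℝ) (u : ℝ → ℝ → ℝ) (t x : ℝ) : ℝ :=
  derivWithin (fun τ => u τ x) (Ico 0 T) t

/-- `u` is a strong solution on `[0,T)` of the Cauchy problem
`m_t + (u² - u_x²)^(n-1) u_x m + ∂_x [(u² - u_x²)^(n-1) u m] = 0`, `m = u - u_xx`, `u(0,·) = u₀`,
in the class `C([0,T); H^s) ∩ C¹([0,T); H^(s-1))`. Each `u t` is the continuous representative of
its class. For `s > 5/2` the functions `u`, `u_x`, `u_xx`, `u_t` are then classical and continuous,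
while `m_t` and `∂_x [...]` are distributions in `x` at each time, and so is the equation. -/
structure IsStrongSolution (n : ℕ) (s T : ℝ) (u₀ : ℝ → ℝ) (u : ℝ → ℝ → ℝ) : Prop where
  continuous : ∀ t ∈ Ico 0 T, Continuous (u t)
  regularity : CurveInHs 0 T s u
  regularity_time : CurveInHs 1 T (s - 1) u
  initial : u 0 = u₀
  equation : ∀ t ∈ Ico 0 T, ∀ φ : ℝ → ℝ, ContDiff ℝ ∞ φ → HasCompactSupport φ →
    ∫ x, (timeDeriv T u t x * (φ x - deriv (deriv φ) x)
      + factor n (u t) x * deriv (u t) x * momentum (u t) x * φ x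
      - factor n (u t) x * u t x * momentum (u t) x * deriv φ x) = 0

/-- `H₁(f) = ∫ (f² + f_x²) dx`. -/
def H₁ (f : ℝ → ℝ) : ℝ := ∫ x, (f x ^ 2 + deriv f x ^ 2)

/-- `H₂(f) = ∫ (f^(2n+1) + ∑_{k=1}^n (-1)^(k+1)/(2k-1) C(n,k) f^(2n-2k+1) f_x^(2k)) dx`. -/
def H₂ (n : ℕ) (f : ℝ → ℝ) : ℝ :=
  ∫ x, (f x ^ (2 * n + 1) + ∑ k ∈ Finset.Icc 1 n,
    (-1 : ℝ) ^ (k + 1) / (2 * (k : ℝ) - 1) * (n.choose k : ℝ)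
      * f x ^ (2 * n - 2 * k + 1) * deriv f x ^ (2 * k))

/-- `c₁ = 1/2 + ∑_{j=1}^n (-1)^(j+1) (2j-3)/(2(2j-1)) C(n,j)`. -/
def c₁ (n : ℕ) : ℝ :=
  1 / 2 + ∑ j ∈ Finset.Icc 1 n,
    (-1 : ℝ) ^ (j + 1) * ((2 * (j : ℝ) - 3) / (2 * (2 * (j : ℝ) - 1))) * (n.choose j : ℝ)

end HOCH

end

/-!
The equation says that `m` solves the linear transport problem `m_t + ∂ₓ(b m) + c m = 0` with
`b = (u² - u_x²)^(n-1) u` and `c = (u² - u_x²)^(n-1) u_x`. Since `m` is only continuous, it is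
mollified at scale `ε`: the commutator is controlled by `m` itself up to its oscillation at that
scale, because `b` is Lipschitz, so a maximum principle bounds the mollified momentum from below
and `ε → 0` gives `m ≥ 0`. Then `u - u_xx ≥ 0` forces `|u_x| ≤ u`.

At each time the density of `H₂` is `u^(2n+1) P(w)` with `w = u_x / u ∈ [-1, 1]`, where
`w dP/dw = P - (1 - w²)^n` and `P(1) = 2 - c₁ ≥ 2`. Hence `(P(w) - (1 + w²) P(1) / 2) / w`
increases to `0` on `(0, 1]`, which gives `P(w) ≤ (1 + w²) P(1) / 2`: the density is at most
`(P(1) / 2) u^(2n-1) (u² + u_x²)`. The deficit `M^(2n-1) - u^(2n-1)` multiplies the square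
`(u ± u_x)²`, whose cross term is an exact derivative; choosing the sign on each side of a maximum
point leaves precisely the term in `M^(2n+1)`.
-/

noncomputable section

open MeasureTheory Set TemperedDistribution FourierTransform Filter Topology
open scoped SchwartzMap ContDiff BoundedContinuousFunction

namespace HOCH

/-! ### Sobolev embedding -/

theorem tendsto_fourierInv_cocompact {E : Type*} [NormedAddCommGroup E] [NormedSpace ℂ E]
    (g : ℝ → E) : Tendsto (𝓕⁻ g) (cocompact ℝ) (𝓝 0) := by
  rw [funext (Real.fourierInv_eq_fourier_neg g)]
  exact (Real.zero_at_infty_fourier g).comp (Homeomorph.neg ℝ).isClosedEmbedding.tendsto_cocompact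

theorem continuous_fourierInv {V E : Type*} [NormedAddCommGroup V] [InnerProductSpace ℝ V]
    [FiniteDimensional ℝ V] [MeasurableSpace V] [BorelSpace V] [NormedAddCommGroup E]
    [NormedSpace ℂ E] {g : V → E} (hg : Integrable g) : Continuous (𝓕⁻ g) := by
  rw [← Real.Lp.fourierTransformInv_toLp (memLp_one_iff_integrable.2 hg)]
  exact BoundedContinuousFunction.continuous _

theorem hasDerivAt_fourierInv {E : Type*} [NormedAddCommGroup E] [NormedSpace ℂ E] {g : ℝ → E}
    (hg : Integrable g) (hg' : Integrable fun ξ : ℝ => ξ • g ξ) (x : ℝ) :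
    HasDerivAt (𝓕⁻ g) (𝓕⁻ (fun ξ : ℝ => (2 * Real.pi * Complex.I * ξ) • g ξ) x) x := by
  rw [funext (Real.fourierInv_eq_fourier_neg g)]
  convert (Real.hasDerivAt_fourier hg hg' (-x)).scomp x (hasDerivAt_neg x) using 1
  · rfl
  rw [Real.fourierInv_eq_fourier_neg, Real.fourier_real_eq, Real.fourier_real_eq, ← integral_smul]
  simp only [neg_mul, neg_smul, smul_neg, one_smul, neg_neg]

theorem integral_fourierInv_smul_eq {V E : Type*} [NormedAddCommGroup V] [InnerProductSpace ℝ V]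
    [FiniteDimensional ℝ V] [MeasurableSpace V] [BorelSpace V] [NormedAddCommGroup E]
    [NormedSpace ℂ E] [CompleteSpace E] {φ : V → ℂ} {g : V → E}
    (hφ : Integrable φ) (hg : Integrable g) : ∫ ξ, 𝓕⁻ φ ξ • g ξ = ∫ x, φ x • 𝓕⁻ g x := by
  have h := VectorFourier.integral_fourierIntegral_smul_eq_flip (μ := volume) (ν := volume)
    (L := innerₗ V) Real.continuous_fourierChar continuous_inner hφ hg.comp_neg
  rw [flip_innerₗ] at h
  calc ∫ ξ, 𝓕⁻ φ ξ • g ξ = ∫ ξ, 𝓕 φ ξ • g (-ξ) := by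
        rw [← integral_neg_eq_self]
        simp only [Real.fourierInv_eq_fourier_neg, neg_neg]
    _ = ∫ x, φ x • 𝓕 (fun ξ => g (-ξ)) x := h
    _ = ∫ x, φ x • 𝓕⁻ g x := by simp only [Real.fourierInv_eq_fourier_comp_neg]

/-- The Fourier symbol of `∂ᵏ` applied to the Bessel potential of order `-s`. -/
def besselSymbol (s : ℝ) (k : ℕ) (ξ : ℝ) : ℂ :=
  (2 * Real.pi * Complex.I * ξ) ^ k * ((1 + ξ ^ 2) ^ (-s / 2) : ℝ)

theorem norm_besselSymbol_sq_le (s : ℝ) (k : ℕ) (ξ : ℝ) :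
    ‖besselSymbol s k ξ‖ ^ 2 ≤ (2 * Real.pi) ^ (2 * k) * (1 + ξ ^ 2) ^ (-(2 * (s - k)) / 2) := by
  have hpos : 0 < 1 + ξ ^ 2 := by positivity
  calc ‖besselSymbol s k ξ‖ ^ 2
      = (2 * Real.pi) ^ (2 * k) * ((ξ ^ 2) ^ k * (1 + ξ ^ 2) ^ (-s)) := by
        rw [besselSymbol, norm_mul, norm_pow, Complex.norm_real, mul_pow,
          Real.norm_of_nonneg (by positivity), ← Real.rpow_mul_natCast hpos.le]
        simp only [norm_mul, Complex.norm_I, Complex.norm_real, Complex.norm_ofNat, mul_one,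
          Real.norm_eq_abs, abs_of_pos Real.pi_pos, ← pow_mul, mul_pow, Nat.cast_ofNat,
          div_mul_cancel₀ (-s) (two_ne_zero' ℝ), mul_comm k 2]
        rw [pow_mul |ξ|, sq_abs, ← pow_mul ξ]
        ring
    _ ≤ (2 * Real.pi) ^ (2 * k) * ((1 + ξ ^ 2) ^ k * (1 + ξ ^ 2) ^ (-s)) := by gcongr; simp
    _ = (2 * Real.pi) ^ (2 * k) * (1 + ξ ^ 2) ^ (-(2 * (s - k)) / 2) := by
        rw [← Real.rpow_natCast (1 + ξ ^ 2) k, ← Real.rpow_add hpos]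
        ring_nf

theorem memLp_besselSymbol {s : ℝ} {k : ℕ} (h : k + 1 / 2 < s) : MemLp (besselSymbol s k) 2 := by
  have hcont : Continuous (besselSymbol s k) := by
    unfold besselSymbol
    have : Continuous fun ξ : ℝ => (1 + ξ ^ 2) ^ (-s / 2) :=
      Continuous.rpow_const (by fun_prop) fun ξ => Or.inl (by positivity)
    fun_prop
  rw [memLp_two_iff_integrable_sq_norm hcont.aestronglyMeasurable]
  have hint := integrable_rpow_neg_one_add_norm_sq (E := ℝ) (μ := volume) (r := 2 * (s - k))
    (by rw [Module.finrank_self, Nat.cast_one]; linarith)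
  simp only [Real.norm_eq_abs, sq_abs] at hint
  refine (hint.const_mul ((2 * Real.pi) ^ (2 * k))).mono' (by fun_prop) (.of_forall fun ξ => ?_)
  rw [Real.norm_of_nonneg (by positivity)]
  exact norm_besselSymbol_sq_le s k ξ

/-- The Fourier transform of `f⁽ᵏ⁾`, where `F` is the Bessel potential of order `s` of `f`. -/
def derivSpectrum (s : ℝ) (k : ℕ) (F : Lp ℂ 2 (volume : Measure ℝ)) (ξ : ℝ) : ℂ :=
  besselSymbol s k ξ * (𝓕 F : Lp ℂ 2 (volume : Measure ℝ)) ξ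

theorem derivSpectrum_succ (s : ℝ) (k : ℕ) (F : Lp ℂ 2 (volume : Measure ℝ)) (ξ : ℝ) :
    derivSpectrum s (k + 1) F ξ = (2 * Real.pi * Complex.I * ξ) • derivSpectrum s k F ξ := by
  rw [derivSpectrum, derivSpectrum, besselSymbol, besselSymbol, pow_succ', smul_eq_mul]
  ring

theorem integrable_derivSpectrum {s : ℝ} {k : ℕ} (h : k + 1 / 2 < s)
    (F : Lp ℂ 2 (volume : Measure ℝ)) : Integrable (derivSpectrum s k F) :=
  (memLp_besselSymbol h).integrable_mul (Lp.memLp _)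

/-- The `k`-th derivative of the function whose Bessel potential of order `s` is `F`, as a bounded
operator in `F` (Sobolev embedding). -/
def sobolevDeriv {s : ℝ} {k : ℕ} (h : k + 1 / 2 < s) :
    Lp ℂ 2 (volume : Measure ℝ) →L[ℝ] (ℝ →ᵇ ℝ) :=
  (Complex.reCLM.compLeftContinuousBounded ℝ) ∘L
    ((Real.Lp.fourierTransformInvCLM ℝ ℂ ∘L
      (ContinuousLinearMap.mul ℂ ℂ).holderL volume 2 2 1 ((memLp_besselSymbol h).toLp _) ∘L
      ((Lp.fourierTransformₗᵢ ℝ ℂ).toContinuousLinearEquiv : _ →L[ℂ] _)).restrictScalars ℝ)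

theorem sobolevDeriv_apply {s : ℝ} {k : ℕ} (h : k + 1 / 2 < s)
    (F : Lp ℂ 2 (volume : Measure ℝ)) (x : ℝ) :
    sobolevDeriv h F x = (𝓕⁻ (derivSpectrum s k F) x).re := by
  refine congrArg Complex.re ((Real.Lp.fourierTransformInv_apply _ x).trans
    (Real.fourierInv_congr_ae ?_ x))
  filter_upwards [(ContinuousLinearMap.mul ℂ ℂ).coeFn_holder (r := 1)
    ((memLp_besselSymbol h).toLp _) (𝓕 F), (memLp_besselSymbol h).coeFn_toLp] with ξ h₁ h₂
  exact h₁.trans (by rw [h₂]; rfl)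

theorem tendsto_sobolevDeriv_cocompact {s : ℝ} {k : ℕ} (h : k + 1 / 2 < s)
    (F : Lp ℂ 2 (volume : Measure ℝ)) : Tendsto (sobolevDeriv h F) (cocompact ℝ) (𝓝 0) := by
  rw [funext (sobolevDeriv_apply h F)]
  exact (Complex.continuous_re.tendsto 0).comp (tendsto_fourierInv_cocompact _)

theorem hasDerivAt_sobolevDeriv {s : ℝ} {k : ℕ} (h : k + 1 / 2 < s) (h' : (k + 1 : ℕ) + 1 / 2 < s)
    (F : Lp ℂ 2 (volume : Measure ℝ)) (x : ℝ) :
    HasDerivAt (sobolevDeriv h F) (sobolevDeriv h' F x) x := by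
  have hξ : Integrable fun ξ : ℝ => ξ • derivSpectrum s k F ξ := by
    have := (integrable_derivSpectrum h' F).const_mul (2 * Real.pi * Complex.I)⁻¹
    refine this.congr (.of_forall fun ξ => ?_)
    simp only [derivSpectrum_succ, Complex.real_smul, smul_eq_mul]
    field_simp [Real.pi_ne_zero, Complex.I_ne_zero]
  have hderiv := hasDerivAt_fourierInv (integrable_derivSpectrum h F) hξ x
  rw [← funext (derivSpectrum_succ s k F)] at hderiv
  rw [funext (sobolevDeriv_apply h F), sobolevDeriv_apply]
  exact Complex.reCLM.hasFDerivAt.comp_hasDerivAt x hderiv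

namespace BesselLift

variable {s : ℝ} {f : ℝ → ℝ} {F : Lp ℂ 2 (volume : Measure ℝ)}

theorem integrable_sq (h : BesselLift s f F) : Integrable fun x => f x ^ 2 := by
  simpa using h.1.norm.integrable_sq

theorem integral_ofReal_mul_eq (h : BesselLift s f F) (hs : 1 / 2 < s) (Φ : 𝓢(ℝ, ℂ)) :
    ∫ x, Φ x * (f x : ℂ) = ∫ x, Φ x * 𝓕⁻ (derivSpectrum s 0 F) x := by
  obtain ⟨hfL, hF⟩ := h
  rw [← besselPotential_neg_apply_eq_iff] at hF
  calc ∫ x, Φ x * (f x : ℂ) = (hfL.toLp : 𝓢'(ℝ, ℂ)) Φ := by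
        rw [Lp.toTemperedDistribution_apply]
        refine integral_congr_ae ?_
        filter_upwards [hfL.coeFn_toLp] with x hx
        rw [hx, smul_eq_mul]
    _ = ∫ ξ, 𝓕⁻ (Φ : ℝ → ℂ) ξ * derivSpectrum s 0 F ξ := by
        rw [← hF, besselPotential, fourierMultiplierCLM_apply,
          TemperedDistribution.fourierInv_apply, smulLeftCLM_apply_apply,
          Lp.fourier_toTemperedDistribution_eq, Lp.toTemperedDistribution_apply]
        refine integral_congr_ae (.of_forall fun ξ => ?_)
        dsimp only
        rw [SchwartzMap.smulLeftCLM_apply_apply (by fun_prop), SchwartzMap.fourierInv_coe]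
        simp only [derivSpectrum, besselSymbol, Real.norm_eq_abs, sq_abs, smul_eq_mul, pow_zero,
          one_mul]
        ring
    _ = ∫ x, Φ x * 𝓕⁻ (derivSpectrum s 0 F) x :=
        integral_fourierInv_smul_eq Φ.integrable (integrable_derivSpectrum (by simpa using hs) F)

theorem ofReal_eq_fourierInv (h : BesselLift s f F) (hs : 1 / 2 < s) (hf : Continuous f) :
    (fun x => (f x : ℂ)) = 𝓕⁻ (derivSpectrum s 0 F) := by
  have hf' : Continuous fun x => (f x : ℂ) := by fun_prop
  have hcont := continuous_fourierInv
    (integrable_derivSpectrum (k := 0) (by simpa using hs) F)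
  rw [← hf'.ae_eq_iff_eq volume hcont]
  refine ae_eq_of_integral_contDiff_smul_eq hf'.locallyIntegrable hcont.locallyIntegrable
    fun φ hφ hφc => ?_
  have hΦc : HasCompactSupport (Complex.ofRealCLM ∘ φ) := hφc.comp_left rfl
  exact h.integral_ofReal_mul_eq hs (hΦc.toSchwartzMap (Complex.ofRealCLM.contDiff.comp hφ))

theorem iterate_deriv_eq (h : BesselLift s f F) (hf : Continuous f) {k : ℕ}
    (hk : k + 1 / 2 < s) : deriv^[k] f = sobolevDeriv hk F := by
  induction k with
  | zero =>
    ext x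
    rw [sobolevDeriv_apply, ← h.ofReal_eq_fourierInv (by simpa using hk) hf]
    rfl
  | succ k ih =>
    have hk' : (k : ℝ) + 1 / 2 < s := by push_cast at hk; linarith
    ext x
    rw [Function.iterate_succ_apply', ih hk', (hasDerivAt_sobolevDeriv hk' hk F x).deriv]

theorem tendsto_iterate_deriv (h : BesselLift s f F) (hf : Continuous f) {k : ℕ}
    (hk : k + 1 / 2 < s) : Tendsto (deriv^[k] f) (cocompact ℝ) (𝓝 0) := by
  rw [h.iterate_deriv_eq hf hk]
  exact tendsto_sobolevDeriv_cocompact hk F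

theorem contDiff (h : BesselLift s f F) (hf : Continuous f) {k : ℕ} (hk : k + 1 / 2 < s) :
    ContDiff ℝ k f := by
  have hlt {j : ℕ} (hj : j ≤ k) : (j : ℝ) + 1 / 2 < s := by
    have : (j : ℝ) ≤ k := mod_cast hj
    linarith
  simp only [contDiff_nat_iff_iteratedDeriv, iteratedDeriv_eq_iterate]
  refine ⟨fun j hj => ?_, fun j hj x => ?_⟩
  · rw [h.iterate_deriv_eq hf (hlt hj)]
    exact BoundedContinuousFunction.continuous _
  · rw [h.iterate_deriv_eq hf (hlt hj.le)]
    exact (hasDerivAt_sobolevDeriv _ (hlt hj) F x).differentiableAt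

end BesselLift

theorem CurveInHs.exists_iterate_deriv {j k : ℕ} {T s : ℝ} {u : ℝ → ℝ → ℝ}
    (h : CurveInHs j T s u) (hu : ∀ t ∈ Ico 0 T, Continuous (u t)) (hk : k + 1 / 2 < s) :
    ∃ V : ℝ → (ℝ →ᵇ ℝ), ContDiffOn ℝ j V (Ico 0 T) ∧ ∀ t ∈ Ico 0 T, deriv^[k] (u t) = V t := by
  obtain ⟨U, hU, hlift⟩ := h
  exact ⟨fun t => sobolevDeriv hk (U t), (sobolevDeriv hk).contDiff.comp_contDiffOn hU,
    fun t ht => (hlift t ht).iterate_deriv_eq (hu t ht) hk⟩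

end HOCH

end

noncomputable section

open MeasureTheory Set Filter Topology Real
open scoped ContDiff BoundedContinuousFunction Uniformity

namespace HOCH

/-! ### A maximum principle for transport inequalities -/

theorem nonneg_of_deriv_pos_at_minimum {X : Type*} [TopologicalSpace X] {z z' : ℝ → X → ℝ}
    {τ : ℝ} {K : Set X} (hK : IsCompact K)
    (hz : ContinuousOn (fun p : ℝ × X => z p.1 p.2) (Icc 0 τ ×ˢ univ))
    (ht : ∀ t ∈ Icc 0 τ, ∀ x, HasDerivWithinAt (fun r => z r x) (z' t x) (Icc 0 τ) t)
    (h0 : ∀ x, 0 ≤ z 0 x) (hKz : ∀ t ∈ Icc 0 τ, ∀ x ∉ K, 0 ≤ z t x)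
    (hmin : ∀ t ∈ Icc 0 τ, ∀ x, z t x < 0 → (∀ y, z t x ≤ z t y) → 0 < z' t x)
    {t : ℝ} (htτ : t ∈ Icc 0 τ) (x : X) : 0 ≤ z t x := by
  by_contra! hneg
  have hxK : x ∈ K := by
    by_contra hx
    exact (hKz t htτ x hx).not_gt hneg
  obtain ⟨⟨t₀, x₀⟩, ⟨ht₀, -⟩, hle⟩ := (isCompact_Icc.prod hK).exists_isMinOn ⟨(t, x), htτ, hxK⟩
    (hz.mono (prod_mono_right (subset_univ K)))
  have hz₀ : z t₀ x₀ < 0 := (hle (a := (t, x)) ⟨htτ, hxK⟩).trans_lt hneg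
  have hglobal : ∀ r ∈ Icc 0 τ, ∀ y, z t₀ x₀ ≤ z r y := fun r hr y => by
    by_cases hy : y ∈ K
    · exact hle (a := (r, y)) ⟨hr, hy⟩
    · exact hz₀.le.trans (hKz r hr y hy)
  have ht₀_pos : 0 < t₀ := ht₀.1.lt_of_ne fun h => (h0 x₀).not_gt (h ▸ hz₀)
  have hpast : (0 : ℝ) - t₀ ∈ posTangentConeAt (Icc 0 τ) t₀ :=
    sub_mem_posTangentConeAt_of_segment_subset
      ((convex_Icc 0 τ).segment_subset ht₀ ⟨le_rfl, ht₀.1.trans ht₀.2⟩)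
  have hmin_time : IsLocalMinOn (fun r => z r x₀) (Icc 0 τ) t₀ :=
    IsMinOn.localize fun r hr => hglobal r hr x₀
  have hderiv := hmin_time.hasFDerivWithinAt_nonneg (ht t₀ ht₀ x₀).hasFDerivWithinAt hpast
  rw [ContinuousLinearMap.toSpanSingleton_apply, smul_eq_mul] at hderiv
  nlinarith [hmin t₀ ht₀ x₀ hz₀ (hglobal t₀ ht₀)]

theorem hasDerivAt_sqrt_one_add_sq (x : ℝ) :
    HasDerivAt (fun y : ℝ => √(1 + y ^ 2)) (x / √(1 + x ^ 2)) x := by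
  convert! ((hasDerivAt_pow 2 x).const_add 1).sqrt (by positivity) using 1
  field_simp
  push_cast
  ring

theorem nonneg_of_transport_nonneg {z z' v b : ℝ → ℝ → ℝ} {τ B W : ℝ}
    (hz : ContinuousOn (fun p : ℝ × ℝ => z p.1 p.2) (Icc 0 τ ×ˢ univ))
    (ht : ∀ t ∈ Icc 0 τ, ∀ x, HasDerivWithinAt (fun r => z r x) (z' t x) (Icc 0 τ) t)
    (hx : ∀ t ∈ Icc 0 τ, ∀ x, HasDerivAt (z t) (v t x) x)
    (h0 : ∀ x, 0 ≤ z 0 x) (hW : ∀ t ∈ Icc 0 τ, ∀ x, -W ≤ z t x)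
    (hb : ∀ t ∈ Icc 0 τ, ∀ x, |b t x| ≤ B)
    (h : ∀ t ∈ Icc 0 τ, ∀ x, z t x < 0 → 0 ≤ z' t x + b t x * v t x)
    {t : ℝ} (htτ : t ∈ Icc 0 τ) (x : ℝ) : 0 ≤ z t x := by
  have hB : 0 ≤ B := (abs_nonneg _).trans (hb t htτ 0)
  -- The penalty forces negative values into a compact set; its slope is at most one, so the term
  -- `(B + 1) * t` absorbs the drift.
  suffices hpen : ∀ η > 0, 0 ≤ z t x + η * (√(1 + x ^ 2) + (B + 1) * t) by
    have hlim : Tendsto (fun η : ℝ => z t x + η * (√(1 + x ^ 2) + (B + 1) * t)) (𝓝[>] 0)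
        (𝓝 (z t x + 0 * (√(1 + x ^ 2) + (B + 1) * t))) :=
      (Continuous.tendsto (by fun_prop) 0).mono_left nhdsWithin_le_nhds
    rw [zero_mul, add_zero] at hlim
    exact ge_of_tendsto hlim (eventually_mem_nhdsWithin.mono hpen)
  intro η hη
  refine nonneg_of_deriv_pos_at_minimum
    (z := fun t x => z t x + η * (√(1 + x ^ 2) + (B + 1) * t))
    (z' := fun t x => z' t x + η * (B + 1)) (isCompact_closedBall (0 : ℝ) (W / η))
    (hz.add (by fun_prop)) (fun t ht' x => ?_) (fun x => ?_) (fun t ht' x hxW => ?_)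
    (fun t ht' x hneg hmin => ?_) htτ x
  · have hlin := (((hasDerivAt_id t).const_mul (B + 1)).const_add √(1 + x ^ 2)).const_mul η
    rw [mul_one] at hlin
    exact (ht t ht' x).fun_add hlin.hasDerivWithinAt
  · have := h0 x
    positivity
  · rw [mem_closedBall_zero_iff, norm_eq_abs, not_le, div_lt_iff₀ hη] at hxW
    have hsqrt : |x| ≤ √(1 + x ^ 2) := abs_le_sqrt (by linarith)
    nlinarith [hW t ht' x, mul_nonneg (by linarith : 0 ≤ B + 1) ht'.1]
  · have hcrit : v t x + η * (x / √(1 + x ^ 2)) = 0 :=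
      IsLocalMin.hasDerivAt_eq_zero (.of_forall hmin) ((hx t ht' x).fun_add
        (((hasDerivAt_sqrt_one_add_sq x).add_const ((B + 1) * t)).const_mul η))
    have hslope : |x / √(1 + x ^ 2)| ≤ 1 := by
      rw [abs_div, abs_of_nonneg (sqrt_nonneg _)]
      exact div_le_one_of_le₀ (abs_le_sqrt (by linarith)) (sqrt_nonneg _)
    have hdrift : b t x * (x / √(1 + x ^ 2)) ≥ -B := by
      refine (abs_le.1 ?_).1
      rw [abs_mul]
      exact (mul_le_mul (hb t ht' x) hslope (abs_nonneg _) hB).trans_eq (mul_one B)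
    have hpenalty : 0 ≤ η * (√(1 + x ^ 2) + (B + 1) * t) := by
      have := ht'.1
      positivity
    have hineq := h t ht' x (by linarith)
    have hbv : b t x * v t x = -(η * (b t x * (x / √(1 + x ^ 2)))) := by
      linear_combination b t x * hcrit
    nlinarith

theorem neg_mul_exp_le_of_transport {w w' v b : ℝ → ℝ → ℝ} {τ K δ B W : ℝ}
    (hK : 0 ≤ K) (hδ : 0 ≤ δ)
    (hw : ContinuousOn (fun p : ℝ × ℝ => w p.1 p.2) (Icc 0 τ ×ˢ univ))
    (ht : ∀ t ∈ Icc 0 τ, ∀ x, HasDerivWithinAt (fun r => w r x) (w' t x) (Icc 0 τ) t)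
    (hx : ∀ t ∈ Icc 0 τ, ∀ x, HasDerivAt (w t) (v t x) x)
    (h0 : ∀ x, 0 ≤ w 0 x) (hW : ∀ t ∈ Icc 0 τ, ∀ x, |w t x| ≤ W)
    (hb : ∀ t ∈ Icc 0 τ, ∀ x, |b t x| ≤ B)
    (h : ∀ t ∈ Icc 0 τ, ∀ x, -(K * (|w t x| + δ)) ≤ w' t x + b t x * v t x)
    {t : ℝ} (htτ : t ∈ Icc 0 τ) (x : ℝ) : -(δ * exp (2 * K * t)) ≤ w t x := by
  have hdamp (r : ℝ) : HasDerivAt (fun r : ℝ => exp (-(2 * K) * r))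
      (exp (-(2 * K) * r) * -(2 * K)) r := by
    simpa using ((hasDerivAt_id r).const_mul (-(2 * K))).exp
  have hnonneg : 0 ≤ exp (-(2 * K) * t) * w t x + δ := by
    refine nonneg_of_transport_nonneg (z := fun t x => exp (-(2 * K) * t) * w t x + δ) (W := W)
      (v := fun t x => exp (-(2 * K) * t) * v t x)
      ((ContinuousOn.mul (by fun_prop) hw).add continuousOn_const)
      (fun t ht' x => ((hdamp t).hasDerivWithinAt.fun_mul (ht t ht' x)).add_const δ)
      (fun t ht' x => ((hx t ht' x).const_mul _).add_const δ) (fun x => ?_) (fun t ht' x => ?_)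
      hb (fun t ht' x hneg => ?_) htτ x
    · simpa using add_nonneg (h0 x) hδ
    · have hle : exp (-(2 * K) * t) ≤ 1 := exp_le_one_iff.2 (by nlinarith [ht'.1])
      nlinarith [abs_le.1 (hW t ht' x), exp_pos (-(2 * K) * t)]
    · have hpos := exp_pos (-(2 * K) * t)
      have hle : exp (-(2 * K) * t) ≤ 1 := exp_le_one_iff.2 (by nlinarith [ht'.1])
      have hwδ : δ < -w t x := by
        by_contra! hle'
        nlinarith
      have htr := h t ht' x
      rw [abs_of_neg (by linarith)] at htr
      have := mul_nonneg hK (sub_nonneg.2 hwδ.le)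
      calc (0 : ℝ) ≤ exp (-(2 * K) * t) * (w' t x + b t x * v t x - 2 * K * w t x) :=
            mul_nonneg hpos.le (by linarith)
        _ = _ := by ring
  have hcancel : exp (2 * K * t) * exp (-(2 * K) * t) = 1 := by
    rw [← exp_add, neg_mul, add_neg_cancel, exp_zero]
  have := mul_nonneg (exp_pos (2 * K * t)).le hnonneg
  linear_combination this + w t x * hcancel

/-! ### Weak transport equations -/

/-- A smooth nonnegative kernel of mass one, supported in `[-ε, ε]`, whose derivative has
`L¹` norm at most `A / ε`. -/
structure IsMollifier (ρ : ℝ → ℝ) (ε A : ℝ) : Prop where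
  contDiff : ContDiff ℝ ∞ ρ
  nonneg : ∀ x, 0 ≤ ρ x
  integral_eq_one : ∫ x, ρ x = 1
  support_subset : Function.support ρ ⊆ Metric.closedBall 0 ε
  integral_abs_deriv_le : ∫ x, |deriv ρ x| ≤ A / ε

theorem exists_isMollifier : ∃ A : ℝ, 0 ≤ A ∧ ∀ ε > 0, ∃ ρ, IsMollifier ρ ε A := by
  let β : ContDiffBump (0 : ℝ) := ⟨1 / 2, 1, by norm_num, by norm_num⟩
  refine ⟨∫ x, |deriv (β.normed volume) x|, integral_nonneg fun x => abs_nonneg _, fun ε hε =>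
    ⟨fun x => ε⁻¹ * β.normed volume (ε⁻¹ * x), ?_⟩⟩
  have hε' : 0 < ε⁻¹ := inv_pos.2 hε
  have hβ : ContDiff ℝ ∞ (β.normed volume) := β.contDiff_normed
  have hderiv (x : ℝ) : deriv (fun x => ε⁻¹ * β.normed volume (ε⁻¹ * x)) x
      = ε⁻¹ * (ε⁻¹ * deriv (β.normed volume) (ε⁻¹ * x)) := by
    rw [deriv_const_mul_field, deriv_comp_mul_left, smul_eq_mul]
  refine ⟨by fun_prop, fun x => mul_nonneg hε'.le (β.nonneg_normed _), ?_, fun x hx => ?_, ?_⟩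
  · rw [integral_const_mul, Measure.integral_comp_mul_left, β.integral_normed, inv_inv,
      abs_of_pos hε, smul_eq_mul, mul_one, inv_mul_cancel₀ hε.ne']
  · have hmem : ε⁻¹ * x ∈ Metric.ball (0 : ℝ) 1 :=
      β.support_normed_eq (μ := volume) ▸ right_ne_zero_of_mul hx
    rw [mem_ball_zero_iff, norm_mul, norm_of_nonneg hε'.le, inv_mul_lt_iff₀ hε, mul_one] at hmem
    exact mem_closedBall_zero_iff.2 hmem.le
  · simp_rw [hderiv, abs_mul, abs_of_pos hε', integral_const_mul]
    rw [Measure.integral_comp_mul_left (fun x => |deriv (β.normed volume) x|), inv_inv,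
      abs_of_pos hε, smul_eq_mul, inv_mul_cancel_left₀ hε.ne', inv_mul_eq_div]

theorem hasCompactSupport_comp_sub {g : ℝ → ℝ} (hg : HasCompactSupport g) (x : ℝ) :
    HasCompactSupport fun y => g (x - y) :=
  hg.comp_homeomorph (Homeomorph.subLeft x)

theorem integrable_mul_comp_sub {m g : ℝ → ℝ} (hm : Continuous m) (hg : Continuous g)
    (hgc : HasCompactSupport g) (x : ℝ) : Integrable fun y => m y * g (x - y) :=
  (hm.mul (hg.comp (by fun_prop))).integrable_of_hasCompactSupport
    (hasCompactSupport_comp_sub hgc x).mul_left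

theorem abs_integral_mul_comp_sub_le {m g : ℝ → ℝ} {x ε N : ℝ} (hg : Integrable g)
    (hgε : Function.support g ⊆ Metric.closedBall 0 ε) (hN : ∀ y, |x - y| ≤ ε → |m y| ≤ N) :
    |∫ y, m y * g (x - y)| ≤ N * ∫ y, |g y| := by
  rw [← integral_sub_left_eq_self (fun y => |g y|) volume x, ← integral_const_mul, ← norm_eq_abs]
  refine norm_integral_le_of_norm_le ((hg.comp_sub_left x).abs.const_mul N) (.of_forall fun y => ?_)
  rw [norm_mul, norm_eq_abs, norm_eq_abs]
  by_cases hy : g (x - y) = 0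
  · rw [hy, abs_zero, mul_zero, mul_zero]
  · exact mul_le_mul_of_nonneg_right (hN y (mem_closedBall_zero_iff.1 (hgε hy))) (abs_nonneg _)

namespace IsMollifier

variable {ρ : ℝ → ℝ} {ε A : ℝ}

theorem continuous (hρ : IsMollifier ρ ε A) : Continuous ρ := hρ.contDiff.continuous

theorem continuous_deriv (hρ : IsMollifier ρ ε A) : Continuous (deriv ρ) :=
  hρ.contDiff.continuous_deriv (by simp)

theorem hasCompactSupport (hρ : IsMollifier ρ ε A) : HasCompactSupport ρ :=
  .of_support_subset_isCompact (isCompact_closedBall 0 ε) hρ.support_subset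

theorem integrable (hρ : IsMollifier ρ ε A) : Integrable ρ :=
  hρ.continuous.integrable_of_hasCompactSupport hρ.hasCompactSupport

theorem integrable_mul (hρ : IsMollifier ρ ε A) {m : ℝ → ℝ} (hm : Continuous m) (x : ℝ) :
    Integrable fun y => m y * ρ (x - y) :=
  integrable_mul_comp_sub hm hρ.continuous hρ.hasCompactSupport x

theorem integrable_mul_deriv (hρ : IsMollifier ρ ε A) {m : ℝ → ℝ} (hm : Continuous m) (x : ℝ) :
    Integrable fun y => m y * deriv ρ (x - y) :=
  integrable_mul_comp_sub hm hρ.continuous_deriv hρ.hasCompactSupport.deriv x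

theorem abs_integral_mul_le (hρ : IsMollifier ρ ε A) {m : ℝ → ℝ} {x N : ℝ}
    (hN : ∀ y, |x - y| ≤ ε → |m y| ≤ N) : |∫ y, m y * ρ (x - y)| ≤ N := by
  simpa only [abs_of_nonneg (hρ.nonneg _), hρ.integral_eq_one, mul_one] using
    abs_integral_mul_comp_sub_le hρ.integrable hρ.support_subset hN

theorem abs_integral_mul_deriv_le (hρ : IsMollifier ρ ε A) {m : ℝ → ℝ} {x N : ℝ} (hN₀ : 0 ≤ N)
    (hN : ∀ y, |x - y| ≤ ε → |m y| ≤ N) : |∫ y, m y * deriv ρ (x - y)| ≤ N * (A / ε) :=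
  (abs_integral_mul_comp_sub_le
    (hρ.continuous_deriv.integrable_of_hasCompactSupport hρ.hasCompactSupport.deriv)
    (support_deriv_subset.trans
      (closure_minimal hρ.support_subset Metric.isClosed_closedBall)) hN).trans
    (mul_le_mul_of_nonneg_left hρ.integral_abs_deriv_le hN₀)

theorem abs_integral_mul_sub_le (hρ : IsMollifier ρ ε A) {m : ℝ → ℝ} (hm : Continuous m) {x θ : ℝ}
    (hθ : ∀ y, |x - y| ≤ ε → |m y - m x| ≤ θ) : |(∫ y, m y * ρ (x - y)) - m x| ≤ θ := by
  have hmass : ∫ y, m x * ρ (x - y) = m x := by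
    rw [integral_const_mul, integral_sub_left_eq_self ρ, hρ.integral_eq_one, mul_one]
  have hsub : (∫ y, m y * ρ (x - y)) - m x = ∫ y, (m y - m x) * ρ (x - y) := by
    simp_rw [sub_mul]
    rw [integral_sub (hρ.integrable_mul hm x) (hρ.integrable_mul continuous_const x), hmass]
  rw [hsub]
  exact hρ.abs_integral_mul_le hθ

theorem abs_commutator_le (hρ : IsMollifier ρ ε A) (hε : 0 < ε) {m b c : ℝ → ℝ} (hm : Continuous m)
    {L C θ x : ℝ} (hL : 0 ≤ L) (hC : 0 ≤ C) (hb : ∀ y, |b x - b y| ≤ L * |x - y|)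
    (hc : ∀ y, |c y| ≤ C) (hθ : ∀ y, |x - y| ≤ ε → |m y - m x| ≤ θ) :
    |(∫ y, (b x - b y) * m y * deriv ρ (x - y)) - ∫ y, c y * m y * ρ (x - y)|
      ≤ (L * A + C) * (|∫ y, m y * ρ (x - y)| + 2 * θ) := by
  set N := |∫ y, m y * ρ (x - y)| + 2 * θ
  have hN (y : ℝ) (hy : |x - y| ≤ ε) : |m y| ≤ N := by
    have htri := abs_sub_abs_le_abs_sub (m x) (∫ y, m y * ρ (x - y))
    rw [abs_sub_comm] at htri
    linarith [abs_sub_abs_le_abs_sub (m y) (m x), hθ y hy, hρ.abs_integral_mul_sub_le hm hθ]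
  have hN₀ : 0 ≤ N := (abs_nonneg _).trans (hN x (by simpa using hε.le))
  have hflux : |∫ y, (b x - b y) * m y * deriv ρ (x - y)| ≤ L * ε * N * (A / ε) := by
    refine hρ.abs_integral_mul_deriv_le (by positivity) fun y hy => ?_
    rw [abs_mul]
    exact mul_le_mul ((hb y).trans (by gcongr)) (hN y hy) (abs_nonneg _) (by positivity)
  have hzero : |∫ y, c y * m y * ρ (x - y)| ≤ C * N := by
    refine hρ.abs_integral_mul_le fun y hy => ?_
    rw [abs_mul]
    exact mul_le_mul (hc y) (hN y hy) (abs_nonneg _) hC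
  calc _ ≤ L * ε * N * (A / ε) + C * N := (abs_sub _ _).trans (add_le_add hflux hzero)
    _ = _ := by field_simp

theorem hasDerivAt_integral_mul (hρ : IsMollifier ρ ε A) {m : ℝ → ℝ} (hm : Continuous m) (x : ℝ) :
    HasDerivAt (fun x => ∫ y, m y * ρ (x - y)) (∫ y, m y * deriv ρ (x - y)) x :=
  hρ.hasCompactSupport.hasDerivAt_convolution_right (ContinuousLinearMap.mul ℝ ℝ)
    (μ := volume) hm.locallyIntegrable (hρ.contDiff.of_le (by simp)) x

theorem lipschitzWith_integral_mul (hρ : IsMollifier ρ ε A) {m : ℝ → ℝ} (hm : Continuous m) {N : ℝ}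
    (hN : ∀ y, |m y| ≤ N) :
    LipschitzWith (N * (A / ε)).toNNReal fun x => ∫ y, m y * ρ (x - y) := by
  refine lipschitzWith_of_nnnorm_deriv_le
    (fun x => (hρ.hasDerivAt_integral_mul hm x).differentiableAt) fun x => ?_
  rw [(hρ.hasDerivAt_integral_mul hm x).deriv]
  exact NNReal.le_toNNReal_of_coe_le
    (hρ.abs_integral_mul_deriv_le ((abs_nonneg _).trans (hN 0)) fun y _ => hN y)

end IsMollifier

/-- `m` solves `m_t + ∂_x (b m) + c m = 0` on `[0, τ] × ℝ` in the sense of distributions in `x`;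
in particular `t ↦ ∫ m(t, y) φ(y) dy` is differentiable for every test function `φ`. -/
def IsWeakTransportSolution (τ : ℝ) (b c m : ℝ → ℝ → ℝ) : Prop :=
  ∀ φ : ℝ → ℝ, ContDiff ℝ ∞ φ → HasCompactSupport φ → ∀ t ∈ Icc 0 τ,
    HasDerivWithinAt (fun r => ∫ y, m r y * φ y)
      (∫ y, (b t y * m t y * deriv φ y - c t y * m t y * φ y)) (Icc 0 τ) t

namespace IsWeakTransportSolution

variable {τ B C N : ℝ} {L : NNReal} {b c m : ℝ → ℝ → ℝ} {ρ : ℝ → ℝ} {ε A : ℝ}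

theorem hasDerivWithinAt_mollified (h : IsWeakTransportSolution τ b c m) (hρ : IsMollifier ρ ε A)
    {t : ℝ} (ht : t ∈ Icc 0 τ) (x : ℝ) :
    HasDerivWithinAt (fun r => ∫ y, m r y * ρ (x - y))
      (∫ y, (b t y * m t y * -deriv ρ (x - y) - c t y * m t y * ρ (x - y))) (Icc 0 τ) t := by
  have := h (fun y => ρ (x - y)) (hρ.contDiff.comp (by fun_prop))
    (hasCompactSupport_comp_sub hρ.hasCompactSupport x) t ht
  simpa only [deriv_comp_const_sub] using this

theorem mollified_transport_eq {b c m : ℝ → ℝ} (hρ : IsMollifier ρ ε A) (hb : Continuous b)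
    (hc : Continuous c) (hm : Continuous m) (x : ℝ) :
    (∫ y, (b y * m y * -deriv ρ (x - y) - c y * m y * ρ (x - y)))
        + b x * ∫ y, m y * deriv ρ (x - y)
      = (∫ y, (b x - b y) * m y * deriv ρ (x - y)) - ∫ y, c y * m y * ρ (x - y) := by
  have hbm := hρ.integrable_mul_deriv (m := fun y => b y * m y) (hb.mul hm) x
  have hcm := hρ.integrable_mul (m := fun y => c y * m y) (hc.mul hm) x
  have hbxm := (hρ.integrable_mul_deriv hm x).const_mul (b x)
  simp only [mul_neg, sub_mul, mul_assoc] at hbm hcm hbxm ⊢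
  rw [integral_sub hbm.fun_neg hcm, integral_sub hbxm hbm, integral_neg, integral_const_mul]
  ring

variable (hb : ∀ t ∈ Icc 0 τ, ∀ x, |b t x| ≤ B) (hbL : ∀ t ∈ Icc 0 τ, LipschitzWith L (b t))
  (hc : ∀ t ∈ Icc 0 τ, Continuous (c t)) (hcC : ∀ t ∈ Icc 0 τ, ∀ x, |c t x| ≤ C)
  (hm : ∀ t ∈ Icc 0 τ, Continuous (m t)) (hmN : ∀ t ∈ Icc 0 τ, ∀ x, |m t x| ≤ N)
  (h0 : ∀ x, 0 ≤ m 0 x)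

include hb hbL hc hcC hm hmN h0

theorem neg_le_of_oscillation_le (h : IsWeakTransportSolution τ b c m) (hρ : IsMollifier ρ ε A)
    (hε : 0 < ε) (hA : 0 ≤ A) {θ : ℝ}
    (hθ : ∀ t ∈ Icc 0 τ, ∀ x y, |x - y| ≤ ε → |m t y - m t x| ≤ θ)
    {t : ℝ} (ht : t ∈ Icc 0 τ) (x : ℝ) :
    -(θ * (2 * exp (2 * (L * A + C) * t) + 1)) ≤ m t x := by
  have hθ₀ : 0 ≤ θ := (abs_nonneg _).trans (hθ t ht x x (by simpa using hε.le))
  have hC : 0 ≤ C := (abs_nonneg _).trans (hcC t ht 0)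
  have hmollified : -(2 * θ * exp (2 * (L * A + C) * t)) ≤ ∫ y, m t y * ρ (x - y) := by
    refine neg_mul_exp_le_of_transport (w := fun t x => ∫ y, m t y * ρ (x - y)) (B := B) (b := b)
      (by positivity) (by positivity) ?_
      (fun t ht x => h.hasDerivWithinAt_mollified hρ ht x)
      (fun t ht x => hρ.hasDerivAt_integral_mul (hm t ht) x)
      (fun x => integral_nonneg fun y => mul_nonneg (h0 y) (hρ.nonneg _))
      (fun t ht x => hρ.abs_integral_mul_le fun y _ => hmN t ht y) hb (fun t ht x => ?_) ht x
    · exact continuousOn_prod_of_continuousOn_lipschitzOnWith' _ _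
        (fun t ht => (hρ.lipschitzWith_integral_mul (hm t ht) (hmN t ht)).lipschitzOnWith)
        (fun x _ t ht => (h.hasDerivWithinAt_mollified hρ ht x).continuousWithinAt)
    · rw [mollified_transport_eq hρ (hbL t ht).continuous (hc t ht) (hm t ht)]
      exact (abs_le.1 (hρ.abs_commutator_le hε (hm t ht) L.coe_nonneg hC
        (fun y => (hbL t ht).dist_le_mul x y) (hcC t ht) (hθ t ht x))).1
  linarith [abs_le.1 (hρ.abs_integral_mul_sub_le (hm t ht) (hθ t ht x))]

theorem nonneg (h : IsWeakTransportSolution τ b c m)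
    (hmU : UniformEquicontinuous fun t : Icc 0 τ => m t) {t : ℝ} (ht : t ∈ Icc 0 τ) (x : ℝ) :
    0 ≤ m t x := by
  obtain ⟨A, hA, hmollifier⟩ := exists_isMollifier
  have hlower : ∀ θ > 0, -(θ * (2 * exp (2 * (L * A + C) * t) + 1)) ≤ m t x := by
    intro θ hθ
    obtain ⟨ε, hε, hosc⟩ := Metric.uniformEquicontinuous_iff.1 hmU θ hθ
    obtain ⟨ρ, hρ⟩ := hmollifier (ε / 2) (by positivity)
    refine h.neg_le_of_oscillation_le hb hbL hc hcC hm hmN h0 hρ (by positivity) hA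
      (fun r hr y z hyz => (hosc z y ?_ ⟨r, hr⟩).le) ht x
    rw [dist_comm]
    exact hyz.trans_lt (half_lt_self hε)
  have hlim : Tendsto (fun θ : ℝ => -(θ * (2 * exp (2 * (L * A + C) * t) + 1))) (𝓝[>] 0)
      (𝓝 (-(0 * (2 * exp (2 * (L * A + C) * t) + 1)))) :=
    (Continuous.tendsto (by fun_prop) 0).mono_left nhdsWithin_le_nhds
  rw [zero_mul, neg_zero] at hlim
  exact le_of_tendsto hlim (eventually_mem_nhdsWithin.mono hlower)

end IsWeakTransportSolution

/-! ### Sign of the momentum -/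

theorem uniformEquicontinuous_of_isCompact {X Y : Type*} [UniformSpace X] [PseudoMetricSpace Y]
    {K : Set (X →ᵇ Y)} (hK : IsCompact K) (h : ∀ f ∈ K, UniformContinuous f) :
    UniformEquicontinuous fun f : K => (f : X → Y) := by
  refine Metric.uniformEquicontinuous_iff_right.2 fun ε hε => ?_
  obtain ⟨net, hnetK, hnet, hcover⟩ := hK.finite_cover_balls (by positivity : 0 < ε / 3)
  have hclose : ∀ᶠ p in 𝓤 X, ∀ g ∈ net, dist (g p.1) (g p.2) < ε / 3 :=
    (eventually_all_finite hnet).2 fun g hg =>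
      h g (hnetK hg) (Metric.dist_mem_uniformity (by positivity))
  filter_upwards [hclose] with p hp f
  obtain ⟨g, hg, hfg⟩ := mem_iUnion₂.1 (hcover f.2)
  have hdist (x : X) : dist ((f : X →ᵇ Y) x) (g x) < ε / 3 :=
    (BoundedContinuousFunction.dist_coe_le_dist x).trans_lt hfg
  calc dist ((f : X →ᵇ Y) p.1) ((f : X →ᵇ Y) p.2)
      ≤ dist ((f : X →ᵇ Y) p.1) (g p.1) + dist (g p.1) (g p.2)
        + dist (g p.2) ((f : X →ᵇ Y) p.2) := dist_triangle4 _ _ _ _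
    _ < ε := by linarith [hdist p.1, hp g hg, dist_comm (g p.2) ((f : X →ᵇ Y) p.2), hdist p.2]

theorem isBoundedLinearMap_integral_mul {X : Type*} [TopologicalSpace X] [MeasurableSpace X]
    [OpensMeasurableSpace X] {μ : Measure X} {ψ : X → ℝ} (hψ : Integrable ψ μ) :
    IsBoundedLinearMap ℝ fun g : X →ᵇ ℝ => ∫ y, g y * ψ y ∂μ := by
  have hint (g : X →ᵇ ℝ) : Integrable (fun y => g y * ψ y) μ :=
    hψ.bdd_mul g.continuous.aestronglyMeasurable (.of_forall g.norm_coe_le_norm)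
  refine IsLinearMap.with_bound ⟨fun g h => ?_, fun a g => ?_⟩ (∫ y, ‖ψ y‖ ∂μ) fun g => ?_
  · simp only [BoundedContinuousFunction.add_apply, add_mul, integral_add (hint g) (hint h)]
  · simp only [BoundedContinuousFunction.smul_apply, smul_eq_mul, mul_assoc, integral_const_mul]
  · rw [mul_comm, ← integral_const_mul]
    refine norm_integral_le_of_norm_le (hψ.norm.const_mul _) (.of_forall fun y => ?_)
    rw [norm_mul]
    exact mul_le_mul_of_nonneg_right (g.norm_coe_le_norm y) (norm_nonneg _)

theorem CurveInHs.exists_timeDeriv {T s : ℝ} {u : ℝ → ℝ → ℝ} (h : CurveInHs 1 T s u)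
    (hu : ∀ t ∈ Ico 0 T, Continuous (u t)) (hs : 1 / 2 < s) :
    ∃ V V' : ℝ → (ℝ →ᵇ ℝ), ∀ t ∈ Ico 0 T,
      u t = V t ∧ timeDeriv T u t = V' t ∧ HasDerivWithinAt V (V' t) (Ico 0 T) t := by
  obtain ⟨V, hV, huV⟩ := h.exists_iterate_deriv (k := 0) hu (by simpa using hs)
  refine ⟨V, derivWithin V (Ico 0 T), fun t ht => ?_⟩
  have hderiv := (hV.differentiableOn (by simp) t ht).hasDerivWithinAt
  refine ⟨huV t ht, funext fun x => ?_, hderiv⟩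
  refine HasDerivWithinAt.derivWithin ?_ (uniqueDiffOn_Ico 0 T t ht)
  exact ((BoundedContinuousFunction.evalCLM ℝ x).hasFDerivAt.comp_hasDerivWithinAt t hderiv).congr
    (fun r hr => congrFun (huV r hr) x) (congrFun (huV t ht) x)

theorem CurveInHs.hasDerivWithinAt_integral_mul {T s : ℝ} {u : ℝ → ℝ → ℝ} (h : CurveInHs 1 T s u)
    (hu : ∀ t ∈ Ico 0 T, Continuous (u t)) (hs : 1 / 2 < s) {ψ : ℝ → ℝ} (hψ : Integrable ψ)
    {t : ℝ} (ht : t ∈ Ico 0 T) :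
    HasDerivWithinAt (fun r => ∫ y, u r y * ψ y) (∫ y, timeDeriv T u t y * ψ y) (Ico 0 T) t := by
  obtain ⟨V, V', hV⟩ := h.exists_timeDeriv hu hs
  have hpair := (isBoundedLinearMap_integral_mul hψ).hasFDerivAt.comp_hasDerivWithinAt t
    (hV t ht).2.2
  rw [(hV t ht).2.1]
  exact hpair.congr (fun r hr => by rw [(hV r hr).1]; rfl) (by rw [(hV t ht).1]; rfl)

theorem contDiff_one_deriv {f : ℝ → ℝ} (hf : ContDiff ℝ 2 f) : ContDiff ℝ 1 (deriv f) :=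
  ContDiff.deriv' hf

theorem continuous_momentum {f : ℝ → ℝ} (hf : ContDiff ℝ 2 f) : Continuous (momentum f) :=
  hf.continuous.sub (contDiff_one_deriv hf).continuous_deriv_one

theorem continuous_factor {f : ℝ → ℝ} (hf : ContDiff ℝ 1 f) (n : ℕ) : Continuous (factor n f) :=
  ((hf.continuous.pow 2).sub (hf.continuous_deriv_one.pow 2)).pow _

theorem hasDerivAt_factor_mul {f : ℝ → ℝ} (hf : ContDiff ℝ 2 f) (n : ℕ) (x : ℝ) :
    HasDerivAt (fun x => factor n f x * f x)
      ((n - 1 : ℕ) * (f x ^ 2 - deriv f x ^ 2) ^ (n - 1 - 1)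
        * (2 * f x * deriv f x - 2 * deriv f x * deriv (deriv f) x) * f x
        + factor n f x * deriv f x) x := by
  have hf₁ := (hf.differentiable (by simp) x).hasDerivAt
  have hf₂ := (hf.differentiable_deriv_two x).hasDerivAt
  have hbase := (hf₁.fun_pow 2).fun_sub (hf₂.fun_pow 2)
  simp only [Nat.cast_ofNat, Nat.add_one_sub_one, pow_one] at hbase
  exact (hbase.fun_pow (n - 1)).fun_mul hf₁

theorem integral_mul_deriv_of_hasCompactSupport {f φ : ℝ → ℝ} (hf : ContDiff ℝ 1 f)
    (hφ : ContDiff ℝ 1 φ) (hφc : HasCompactSupport φ) :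
    ∫ x, f x * deriv φ x = -∫ x, deriv f x * φ x :=
  integral_mul_deriv_eq_deriv_mul_of_integrable
    (fun x _ => (hf.differentiable_one x).hasDerivAt)
    (fun x _ => (hφ.differentiable_one x).hasDerivAt)
    ((hf.continuous.mul hφ.continuous_deriv_one).integrable_of_hasCompactSupport
      hφc.deriv.mul_left)
    ((hf.continuous_deriv_one.mul hφ.continuous).integrable_of_hasCompactSupport hφc.mul_left)
    ((hf.continuous.mul hφ.continuous).integrable_of_hasCompactSupport hφc.mul_left)

theorem integral_momentum_mul {f φ : ℝ → ℝ} (hf : ContDiff ℝ 2 f) (hφ : ContDiff ℝ 2 φ)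
    (hφc : HasCompactSupport φ) :
    ∫ x, momentum f x * φ x = ∫ x, f x * (φ x - deriv (deriv φ) x) := by
  have hφ'' := (contDiff_one_deriv hφ).continuous_deriv_one
  have hparts : ∫ x, f x * deriv (deriv φ) x = ∫ x, deriv (deriv f) x * φ x := by
    rw [integral_mul_deriv_of_hasCompactSupport (hf.of_le one_le_two) (contDiff_one_deriv hφ)
        hφc.deriv,
      integral_mul_deriv_of_hasCompactSupport (contDiff_one_deriv hf) (hφ.of_le one_le_two) hφc,
      neg_neg]
  have hint : Integrable fun x => f x * φ x :=
    (hf.continuous.mul hφ.continuous).integrable_of_hasCompactSupport hφc.mul_left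
  simp_rw [momentum, sub_mul, mul_sub]
  rw [integral_sub hint, integral_sub hint, hparts]
  · exact (hf.continuous.mul hφ'').integrable_of_hasCompactSupport hφc.deriv.deriv.mul_left
  · exact ((contDiff_one_deriv hf).continuous_deriv_one.mul
      hφ.continuous).integrable_of_hasCompactSupport hφc.mul_left

namespace IsStrongSolution

variable {n : ℕ} {s T τ : ℝ} {u₀ : ℝ → ℝ} {u : ℝ → ℝ → ℝ}

theorem contDiff (hu : IsStrongSolution n s T u₀ u) (hs : 5 / 2 < s) {t : ℝ} (ht : t ∈ Ico 0 T) :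
    ContDiff ℝ 2 (u t) := by
  obtain ⟨U, -, hU⟩ := hu.regularity
  exact (hU t ht).contDiff (hu.continuous t ht) (k := 2) (by norm_num; exact hs)

theorem exists_boundedContinuousFunction (hu : IsStrongSolution n s T u₀ u) (hτ : τ < T) {k : ℕ}
    (hk : k + 1 / 2 < s) : ∃ V : ℝ → (ℝ →ᵇ ℝ), ContinuousOn V (Icc 0 τ) ∧
      ∀ t ∈ Icc 0 τ, deriv^[k] (u t) = V t := by
  obtain ⟨V, hV, huV⟩ := hu.regularity.exists_iterate_deriv hu.continuous hk
  have hsub : Icc 0 τ ⊆ Ico 0 T := Icc_subset_Ico_right hτ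
  exact ⟨V, hV.continuousOn.mono hsub, fun t ht => huV t (hsub ht)⟩

theorem exists_abs_iterate_deriv_le (hu : IsStrongSolution n s T u₀ u) (hτ : τ < T) {k : ℕ}
    (hk : k + 1 / 2 < s) : ∃ R, ∀ t ∈ Icc 0 τ, ∀ x, |deriv^[k] (u t) x| ≤ R := by
  obtain ⟨V, hV, huV⟩ := hu.exists_boundedContinuousFunction hτ hk
  obtain ⟨R, hR⟩ := isCompact_Icc.exists_bound_of_continuousOn hV
  refine ⟨R, fun t ht x => ?_⟩
  rw [huV t ht]
  exact ((V t).norm_coe_le_norm x).trans (hR t ht)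

theorem exists_abs_comp_jet_le (hu : IsStrongSolution n s T u₀ u) (hs : 5 / 2 < s) (hτ : τ < T)
    {g : ℝ × ℝ × ℝ → ℝ} (hg : Continuous g) :
    ∃ C, ∀ t ∈ Icc 0 τ, ∀ x, |g (u t x, deriv (u t) x, deriv (deriv (u t)) x)| ≤ C := by
  obtain ⟨R₀, hR₀⟩ := hu.exists_abs_iterate_deriv_le (k := 0) hτ (by norm_num; linarith)
  obtain ⟨R₁, hR₁⟩ := hu.exists_abs_iterate_deriv_le (k := 1) hτ (by norm_num; linarith)
  obtain ⟨R₂, hR₂⟩ := hu.exists_abs_iterate_deriv_le (k := 2) hτ (by norm_num; linarith)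
  obtain ⟨C, hC⟩ := ((isCompact_closedBall (0 : ℝ) R₀).prod ((isCompact_closedBall (0 : ℝ) R₁).prod
    (isCompact_closedBall (0 : ℝ) R₂))).exists_bound_of_continuousOn hg.continuousOn
  exact ⟨C, fun t ht x => hC _ ⟨mem_closedBall_zero_iff.2 (hR₀ t ht x),
    mem_closedBall_zero_iff.2 (hR₁ t ht x), mem_closedBall_zero_iff.2 (hR₂ t ht x)⟩⟩

theorem uniformEquicontinuous_iterate_deriv (hu : IsStrongSolution n s T u₀ u) (hτ : τ < T) {k : ℕ}
    (hk : k + 1 / 2 < s) : UniformEquicontinuous fun t : Icc 0 τ => deriv^[k] (u t) := by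
  obtain ⟨V, hV, huV⟩ := hu.exists_boundedContinuousFunction hτ hk
  obtain ⟨U, -, hU⟩ := hu.regularity
  have hslice : ∀ f ∈ V '' Icc 0 τ, UniformContinuous f := by
    rintro - ⟨t, ht, rfl⟩
    have htT : t ∈ Ico 0 T := Icc_subset_Ico_right hτ ht
    refine Continuous.uniformContinuous_of_tendsto_cocompact (x := 0) (V t).continuous ?_
    rw [← huV t ht]
    exact (hU t htT).tendsto_iterate_deriv (hu.continuous t htT) hk
  have hV_equi := uniformEquicontinuous_of_isCompact (isCompact_Icc.image_of_continuousOn hV) hslice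
  have := hV_equi.comp fun t : Icc 0 τ => (⟨V t, mem_image_of_mem V t.2⟩ : V '' Icc 0 τ)
  convert this with t
  exact huV t t.2

theorem uniformEquicontinuous_momentum (hu : IsStrongSolution n s T u₀ u) (hs : 5 / 2 < s)
    (hτ : τ < T) : UniformEquicontinuous fun t : Icc 0 τ => momentum (u t) := by
  have h₀ := hu.uniformEquicontinuous_iterate_deriv (k := 0) hτ (by norm_num; linarith)
  have h₂ := hu.uniformEquicontinuous_iterate_deriv (k := 2) hτ (by norm_num; linarith)
  rw [Metric.uniformEquicontinuous_iff_right] at h₀ h₂ ⊢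
  intro ε hε
  filter_upwards [h₀ (ε / 2) (half_pos hε), h₂ (ε / 2) (half_pos hε)] with p hp₀ hp₂ t
  exact (dist_sub_sub_le _ _ _ _).trans_lt
    ((add_lt_add (hp₀ t) (hp₂ t)).trans_eq (add_halves ε))

theorem integral_timeDeriv_mul_eq (hu : IsStrongSolution n s T u₀ u) (hs : 5 / 2 < s) {t : ℝ}
    (ht : t ∈ Ico 0 T) {φ : ℝ → ℝ} (hφ : ContDiff ℝ ∞ φ) (hφc : HasCompactSupport φ) :
    ∫ x, timeDeriv T u t x * (φ x - deriv (deriv φ) x) =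
      ∫ x, (factor n (u t) x * u t x * momentum (u t) x * deriv φ x
        - factor n (u t) x * deriv (u t) x * momentum (u t) x * φ x) := by
  have hu2 := hu.contDiff hs ht
  have hφ2 : ContDiff ℝ 2 φ := contDiff_infty.1 hφ 2
  obtain ⟨V, V', hV⟩ := hu.regularity_time.exists_timeDeriv hu.continuous (by linarith)
  have hint_time : Integrable fun x => timeDeriv T u t x * (φ x - deriv (deriv φ) x) := by
    rw [(hV t ht).2.1]
    exact ((V' t).continuous.mul (hφ.continuous.sub
      (contDiff_one_deriv hφ2).continuous_deriv_one)).integrable_of_hasCompactSupport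
      (hφc.sub hφc.deriv.deriv).mul_left
  have hfactor := continuous_factor (hu2.of_le one_le_two) n
  have hm := continuous_momentum hu2
  have hint_source :
      Integrable fun x => factor n (u t) x * deriv (u t) x * momentum (u t) x * φ x :=
    (((hfactor.mul (hu2.of_le one_le_two).continuous_deriv_one).mul hm).mul
      hφ.continuous).integrable_of_hasCompactSupport hφc.mul_left
  have hint_flux :
      Integrable fun x => factor n (u t) x * u t x * momentum (u t) x * deriv φ x :=
    (((hfactor.mul hu2.continuous).mul hm).mul
      (hφ2.of_le one_le_two).continuous_deriv_one).integrable_of_hasCompactSupport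
      hφc.deriv.mul_left
  have heq := hu.equation t ht φ hφ hφc
  rw [integral_sub (hint_time.fun_add hint_source) hint_flux,
    integral_add hint_time hint_source] at heq
  rw [integral_sub hint_flux hint_source]
  linarith

theorem isWeakTransportSolution_momentum (hu : IsStrongSolution n s T u₀ u) (hs : 5 / 2 < s)
    (hτ : τ < T) :
    IsWeakTransportSolution τ (fun t x => factor n (u t) x * u t x)
      (fun t x => factor n (u t) x * deriv (u t) x) fun t => momentum (u t) := by
  intro φ hφ hφc t ht
  have hsub : Icc 0 τ ⊆ Ico 0 T := Icc_subset_Ico_right hτ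
  have hφ2 : ContDiff ℝ 2 φ := contDiff_infty.1 hφ 2
  have hψ : Integrable fun x => φ x - deriv (deriv φ) x :=
    (hφ.continuous.sub
      (contDiff_one_deriv hφ2).continuous_deriv_one).integrable_of_hasCompactSupport
      (hφc.sub hφc.deriv.deriv)
  have hpair := (hu.regularity_time.hasDerivWithinAt_integral_mul hu.continuous (by linarith) hψ
    (hsub ht)).mono hsub
  rw [hu.integral_timeDeriv_mul_eq hs (hsub ht) hφ hφc] at hpair
  have hparts (r : ℝ) (hr : r ∈ Icc 0 τ) :=
    integral_momentum_mul (hu.contDiff hs (hsub hr)) hφ2 hφc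
  exact hpair.congr hparts (hparts t ht)

theorem momentum_nonneg (hu : IsStrongSolution n s T u₀ u) (hs : 5 / 2 < s)
    (hm₀ : ∀ x, 0 ≤ momentum u₀ x) {t : ℝ} (ht : t ∈ Ico 0 T) (x : ℝ) : 0 ≤ momentum (u t) x := by
  have hsub : Icc 0 t ⊆ Ico 0 T := Icc_subset_Ico_right ht.2
  have hC2 (r : ℝ) (hr : r ∈ Icc 0 t) : ContDiff ℝ 2 (u r) := hu.contDiff hs (hsub hr)
  obtain ⟨B, hB⟩ := hu.exists_abs_comp_jet_le hs ht.2
    (g := fun p => (p.1 ^ 2 - p.2.1 ^ 2) ^ (n - 1) * p.1) (by fun_prop)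
  obtain ⟨C, hC⟩ := hu.exists_abs_comp_jet_le hs ht.2
    (g := fun p => (p.1 ^ 2 - p.2.1 ^ 2) ^ (n - 1) * p.2.1) (by fun_prop)
  obtain ⟨N, hN⟩ := hu.exists_abs_comp_jet_le hs ht.2 (g := fun p => p.1 - p.2.2) (by fun_prop)
  obtain ⟨L, hL⟩ := hu.exists_abs_comp_jet_le hs ht.2
    (g := fun p => (n - 1 : ℕ) * (p.1 ^ 2 - p.2.1 ^ 2) ^ (n - 1 - 1)
      * (2 * p.1 * p.2.1 - 2 * p.2.1 * p.2.2) * p.1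
      + (p.1 ^ 2 - p.2.1 ^ 2) ^ (n - 1) * p.2.1) (by fun_prop)
  refine (hu.isWeakTransportSolution_momentum hs ht.2).nonneg (L := L.toNNReal) (by exact hB)
    (fun r hr => ?_) (fun r hr => ?_) (by exact hC)
    (fun r hr => continuous_momentum (hC2 r hr)) (by exact hN)
    (by simpa only [hu.initial] using hm₀) (hu.uniformEquicontinuous_momentum hs ht.2)
    ⟨ht.1, le_rfl⟩ x
  · have hderiv := hasDerivAt_factor_mul (hC2 r hr) n
    refine lipschitzWith_of_nnnorm_deriv_le (fun y => (hderiv y).differentiableAt) fun y => ?_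
    rw [(hderiv y).deriv]
    exact NNReal.le_toNNReal_of_coe_le (hL r hr y)
  · exact (continuous_factor ((hC2 r hr).of_le one_le_two) n).mul
      ((hC2 r hr).of_le one_le_two).continuous_deriv_one

end IsStrongSolution

/-! ### The energy inequality at a fixed time -/

theorem nonneg_of_deriv_le_self {g : ℝ → ℝ} {B : ℝ} (hg : Differentiable ℝ g)
    (hB : ∀ x, B ≤ g x) (h : ∀ x, deriv g x ≤ g x) (x : ℝ) : 0 ≤ g x := by
  have hderiv (y : ℝ) :
      HasDerivAt (fun y => exp (-y) * g y) (exp (-y) * (deriv g y - g y)) y := by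
    convert! (hasDerivAt_neg y).exp.fun_mul (hg y).hasDerivAt using 1
    ring
  have hanti : Antitone fun y => exp (-y) * g y :=
    antitone_of_hasDerivAt_nonpos hderiv fun y =>
      mul_nonpos_of_nonneg_of_nonpos (exp_pos _).le (sub_nonpos.2 (h y))
  have hlim : Tendsto (fun y => exp (-y) * B) atTop (𝓝 0) := by
    simpa using tendsto_exp_neg_atTop_nhds_zero.mul_const B
  refine nonneg_of_mul_nonneg_right (le_of_tendsto hlim ?_) (exp_pos (-x))
  filter_upwards [eventually_ge_atTop x] with y hy
  exact (mul_le_mul_of_nonneg_left (hB y) (exp_pos _).le).trans (hanti hy)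

theorem neg_deriv_le_of_momentum_nonneg {f : ℝ → ℝ} {B B' : ℝ} (hf : ContDiff ℝ 2 f)
    (hB : ∀ x, |f x| ≤ B) (hB' : ∀ x, |deriv f x| ≤ B') (hm : ∀ x, 0 ≤ momentum f x) (x : ℝ) :
    -deriv f x ≤ f x := by
  have hsum (y : ℝ) : HasDerivAt (fun y => f y + deriv f y) (deriv f y + deriv (deriv f) y) y :=
    (hf.differentiable (by simp) y).hasDerivAt.fun_add (hf.differentiable_deriv_two y).hasDerivAt
  refine neg_le_iff_add_nonneg.2 (nonneg_of_deriv_le_self (B := -B + -B')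
    (fun y => (hsum y).differentiableAt) (fun y => ?_) (fun y => ?_) x)
  · exact add_le_add (neg_le_of_abs_le (hB y)) (neg_le_of_abs_le (hB' y))
  · rw [(hsum y).deriv, add_comm]
    exact add_le_add_left (sub_nonneg.1 (hm y)) _

theorem momentum_comp_neg (f : ℝ → ℝ) (x : ℝ) :
    momentum (fun y => f (-y)) x = momentum f (-x) := by
  have hderiv : deriv (fun y => f (-y)) = fun y => -deriv f (-y) :=
    funext fun y => deriv_comp_neg f y
  rw [momentum, hderiv, deriv.fun_neg, deriv_comp_neg, neg_neg, momentum]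

theorem abs_deriv_le_of_momentum_nonneg {f : ℝ → ℝ} {B B' : ℝ} (hf : ContDiff ℝ 2 f)
    (hB : ∀ x, |f x| ≤ B) (hB' : ∀ x, |deriv f x| ≤ B') (hm : ∀ x, 0 ≤ momentum f x) (x : ℝ) :
    |deriv f x| ≤ f x := by
  refine abs_le'.2 ⟨?_, neg_deriv_le_of_momentum_nonneg hf hB hB' hm x⟩
  have hreflected := neg_deriv_le_of_momentum_nonneg (f := fun y => f (-y)) (B' := B')
    (hf.comp contDiff_neg) (fun y => hB (-y))
    (fun y => by rw [deriv_comp_neg, abs_neg]; exact hB' (-y))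
    (fun y => by rw [momentum_comp_neg]; exact hm (-y)) (-x)
  simpa only [deriv_comp_neg, neg_neg] using hreflected

theorem IsStrongSolution.abs_deriv_le {n : ℕ} {s T : ℝ} {u₀ : ℝ → ℝ} {u : ℝ → ℝ → ℝ}
    (hu : IsStrongSolution n s T u₀ u) (hs : 5 / 2 < s) (hm₀ : ∀ x, 0 ≤ momentum u₀ x) {t : ℝ}
    (ht : t ∈ Ico 0 T) (x : ℝ) : |deriv (u t) x| ≤ u t x := by
  have htt : t ∈ Icc 0 t := ⟨ht.1, le_rfl⟩
  obtain ⟨B, hB⟩ := hu.exists_abs_iterate_deriv_le (k := 0) ht.2 (by norm_num; linarith)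
  obtain ⟨B', hB'⟩ := hu.exists_abs_iterate_deriv_le (k := 1) ht.2 (by norm_num; linarith)
  exact abs_deriv_le_of_momentum_nonneg (hu.contDiff hs ht) (hB t htt) (hB' t htt)
    (hu.momentum_nonneg hs hm₀ ht) x

theorem exists_forall_le_of_tendsto_cocompact {X : Type*} [TopologicalSpace X] [Nonempty X]
    {f : X → ℝ} (hf : Continuous f) (h₀ : ∀ x, 0 ≤ f x) (hlim : Tendsto f (cocompact X) (𝓝 0)) :
    ∃ ξ, ∀ x, f x ≤ f ξ := by
  by_cases h : ∃ x₀, 0 < f x₀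
  · obtain ⟨x₀, hx₀⟩ := h
    exact hf.exists_forall_ge' x₀ ((hlim.eventually_lt_const hx₀).mono fun x hx => hx.le)
  · push Not at h
    obtain ⟨ξ⟩ := ‹Nonempty X›
    exact ⟨ξ, fun x => (h x).trans (h₀ ξ)⟩

/-- The integrand of `H₂ n` at `f x = u`, `f_x x = v`. The term `k = 0` of the sum is
`u^(2n+1)`, since `(-1) / (2 * 0 - 1) = 1`. -/
def energyDensity (n : ℕ) (u v : ℝ) : ℝ :=
  ∑ k ∈ Finset.range (n + 1), (-1 : ℝ) ^ (k + 1) / (2 * (k : ℝ) - 1) * (n.choose k : ℝ)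
    * u ^ (2 * n - 2 * k + 1) * v ^ (2 * k)

/-- The energy density at `u = 1`; by homogeneity it determines `energyDensity`. -/
def energyProfile (n : ℕ) (w : ℝ) : ℝ :=
  ∑ k ∈ Finset.range (n + 1), (-1 : ℝ) ^ (k + 1) / (2 * (k : ℝ) - 1) * (n.choose k : ℝ)
    * w ^ (2 * k)

theorem sum_range_succ_eq_add_sum_Icc (n : ℕ) (g : ℕ → ℝ) :
    ∑ k ∈ Finset.range (n + 1), g k = g 0 + ∑ k ∈ Finset.Icc 1 n, g k := by
  rw [Finset.sum_range_eq_add_Ico g n.succ_pos, Nat.succ_eq_add_one,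
    Finset.Ico_add_one_right_eq_Icc]

theorem two_mul_natCast_sub_one_ne_zero (k : ℕ) : 2 * (k : ℝ) - 1 ≠ 0 := by
  have : 2 * (k : ℤ) - 1 ≠ 0 := by omega
  exact_mod_cast this

theorem H₂_eq_integral_energyDensity (n : ℕ) (f : ℝ → ℝ) :
    H₂ n f = ∫ x, energyDensity n (f x) (deriv f x) := by
  simp [H₂, energyDensity, sum_range_succ_eq_add_sum_Icc]

theorem energyDensity_eq_pow_mul_energyProfile (n : ℕ) (u v : ℝ) :
    energyDensity n u v = u ^ (2 * n + 1) * energyProfile n (v / u) := by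
  rw [energyDensity, energyProfile, Finset.mul_sum]
  refine Finset.sum_congr rfl fun k hk => ?_
  have hkn : k ≤ n := Finset.mem_range_succ_iff.1 hk
  rcases eq_or_ne u 0 with rfl | hu
  · simp
  · have hpow : u ^ (2 * n + 1) = u ^ (2 * n - 2 * k + 1) * u ^ (2 * k) := by
      rw [← pow_add]
      congr 1
      omega
    rw [hpow, div_pow]
    field_simp

theorem energyDensity_neg (n : ℕ) (u v : ℝ) : energyDensity n u (-v) = energyDensity n u v := by
  simp only [energyDensity, (even_two_mul _).neg_pow]

theorem continuous_energyDensity (n : ℕ) :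
    Continuous fun p : ℝ × ℝ => energyDensity n p.1 p.2 := by
  unfold energyDensity
  fun_prop

theorem energyProfile_zero (n : ℕ) : energyProfile n 0 = 1 := by
  simp [energyProfile, zero_pow_eq]

theorem energyProfile_abs (n : ℕ) (w : ℝ) : energyProfile n |w| = energyProfile n w := by
  simp only [energyProfile, (even_two_mul _).pow_abs]

theorem alternating_sum_choose {n : ℕ} (hn : n ≠ 0) :
    ∑ k ∈ Finset.range (n + 1), (-1 : ℝ) ^ k * (n.choose k : ℝ) = 0 := by
  exact_mod_cast Int.alternating_sum_range_choose_of_ne hn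

theorem two_sub_c₁ {n : ℕ} (hn : n ≠ 0) : 2 - c₁ n = energyProfile n 1 := by
  have hterm (k : ℕ) : (-1 : ℝ) ^ (k + 1) * ((2 * (k : ℝ) - 3) / (2 * (2 * (k : ℝ) - 1)))
        * (n.choose k : ℝ)
      = -(1 / 2) * ((-1) ^ k * (n.choose k : ℝ))
        - (-1) ^ (k + 1) / (2 * (k : ℝ) - 1) * (n.choose k : ℝ) * 1 ^ (2 * k) := by
    have := two_mul_natCast_sub_one_ne_zero k
    rw [one_pow, pow_succ]
    field_simp
    ring
  have hsum := sum_range_succ_eq_add_sum_Icc n fun k =>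
    (-1 : ℝ) ^ (k + 1) * ((2 * (k : ℝ) - 3) / (2 * (2 * (k : ℝ) - 1))) * (n.choose k : ℝ)
  simp only [hterm, Finset.sum_sub_distrib, ← Finset.mul_sum, alternating_sum_choose hn] at hsum
  rw [c₁, energyProfile]
  simp only [hterm, Finset.sum_sub_distrib, ← Finset.mul_sum]
  norm_num at hsum ⊢
  linarith

/-- The derivative of `energyProfile n`. -/
def energyProfileDeriv (n : ℕ) (w : ℝ) : ℝ :=
  ∑ k ∈ Finset.range (n + 1), (-1 : ℝ) ^ (k + 1) / (2 * (k : ℝ) - 1) * (n.choose k : ℝ)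
    * ((2 * k : ℕ) * w ^ (2 * k - 1))

theorem hasDerivAt_energyProfile (n : ℕ) (w : ℝ) :
    HasDerivAt (energyProfile n) (energyProfileDeriv n w) w :=
  HasDerivAt.fun_sum fun k _ => (hasDerivAt_pow (2 * k) w).const_mul _

theorem energyProfileDeriv_zero (n : ℕ) : energyProfileDeriv n 0 = 0 := by
  refine Finset.sum_eq_zero fun k _ => ?_
  rcases eq_or_ne k 0 with rfl | hk
  · simp
  · rw [zero_pow (by omega), mul_zero, mul_zero]

theorem mul_energyProfileDeriv (n : ℕ) (w : ℝ) :
    w * energyProfileDeriv n w = energyProfile n w - (1 - w ^ 2) ^ n := by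
  rw [sub_eq_neg_add 1, add_pow, energyProfileDeriv, energyProfile, Finset.mul_sum,
    ← Finset.sum_sub_distrib]
  refine Finset.sum_congr rfl fun k _ => ?_
  have hk := two_mul_natCast_sub_one_ne_zero k
  have hpow : w * ((2 * k : ℕ) * w ^ (2 * k - 1)) = 2 * k * w ^ (2 * k) := by
    rcases eq_or_ne k 0 with rfl | hk
    · simp
    · rw [mul_left_comm, mul_pow_sub_one (by omega)]
      push_cast
      ring
  rw [mul_left_comm, hpow, neg_pow (w ^ 2), ← pow_mul, one_pow, pow_succ]
  field_simp
  ring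

theorem le_mul_of_le_mul_deriv {h h' : ℝ → ℝ} (hh : ∀ x, HasDerivAt h (h' x) x)
    (hle : ∀ x ∈ Ioo 0 1, h x ≤ x * h' x) : ∀ x ∈ Icc 0 1, h x ≤ x * h 1 := by
  have hmono : MonotoneOn (fun x => h x / x) (Ioc 0 1) := by
    have hquot (x : ℝ) (hx : x ∈ Ioc 0 1) :
        HasDerivAt (fun x => h x / x) ((h' x * x - h x * 1) / x ^ 2) x :=
      (hh x).fun_div (hasDerivAt_id' x) hx.1.ne'
    refine monotoneOn_of_hasDerivWithinAt_nonneg (convex_Ioc 0 1)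
      (fun x hx => (hquot x hx).continuousAt.continuousWithinAt)
      (fun x hx => (hquot x (interior_subset hx)).hasDerivWithinAt) fun x hx => ?_
    rw [interior_Ioc] at hx
    exact div_nonneg (by linarith [hle x hx]) (sq_nonneg x)
  have hcont : Continuous h := continuous_iff_continuousAt.2 fun x => (hh x).continuousAt
  have hclosed : IsClosed {x | h x ≤ x * h 1} := isClosed_le hcont (by fun_prop)
  rw [← closure_Ioc zero_ne_one]
  refine closure_minimal (fun x hx => ?_) hclosed
  have hle_one : h x / x ≤ h 1 / 1 := hmono hx (right_mem_Ioc.2 zero_lt_one) hx.2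
  exact (div_le_iff₀' hx.1).1 (hle_one.trans_eq (div_one _))

theorem energyProfile_sub_le {n : ℕ} (hn : n ≠ 0) {a : ℝ} (ha : 1 ≤ a) {w : ℝ} (hw : |w| ≤ 1) :
    energyProfile n w - a * (1 + w ^ 2) ≤ |w| * (energyProfile n 1 - 2 * a) := by
  have hderiv (x : ℝ) : HasDerivAt (fun x => energyProfile n x - a * (1 + x ^ 2))
      (energyProfileDeriv n x - a * (2 * x)) x := by
    convert! (hasDerivAt_energyProfile n x).fun_sub
      (((hasDerivAt_pow 2 x).const_add 1).const_mul a) using 1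
    simp
  have hle := le_mul_of_le_mul_deriv hderiv (fun x hx => ?_) |w| ⟨abs_nonneg w, hw⟩
  · rw [energyProfile_abs, sq_abs] at hle
    exact hle.trans_eq (by ring)
  · have hx2 : 0 ≤ 1 - x ^ 2 := by nlinarith [hx.1, hx.2]
    have hpow : (1 - x ^ 2) ^ n ≤ a * (1 - x ^ 2) :=
      (pow_le_of_le_one hx2 (by linarith [sq_nonneg x]) hn).trans (le_mul_of_one_le_left hx2 ha)
    linarith [mul_energyProfileDeriv n x]

theorem two_le_energyProfile_one {n : ℕ} (hn : n ≠ 0) : 2 ≤ energyProfile n 1 := by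
  have hderiv : HasDerivAt (fun x => energyProfile n x - (1 + x ^ 2)) 0 0 := by
    convert! (hasDerivAt_energyProfile n 0).fun_sub ((hasDerivAt_pow 2 0).const_add 1) using 1
    simp [energyProfileDeriv_zero]
  refine sub_nonneg.1 (le_of_tendsto hderiv.tendsto_slope_zero_right ?_)
  filter_upwards [Ioc_mem_nhdsGT zero_lt_one] with x hx
  have hle := energyProfile_sub_le hn le_rfl ((abs_of_pos hx.1).trans_le hx.2)
  rw [abs_of_pos hx.1] at hle
  simpa [energyProfile_zero, inv_mul_le_iff₀ hx.1] using hle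

theorem energyProfile_le {n : ℕ} (hn : n ≠ 0) {w : ℝ} (hw : |w| ≤ 1) :
    energyProfile n w ≤ energyProfile n 1 / 2 * (1 + w ^ 2) := by
  have hle := energyProfile_sub_le hn (a := energyProfile n 1 / 2)
    (by linarith [two_le_energyProfile_one hn]) hw
  rwa [mul_div_cancel₀ _ two_ne_zero, sub_self, mul_zero, sub_nonpos] at hle

theorem energyDensity_le {n : ℕ} (hn : n ≠ 0) {u v : ℝ} (h : |v| ≤ u) :
    energyDensity n u v ≤ energyProfile n 1 / 2 * u ^ (2 * n - 1) * (u ^ 2 + v ^ 2) := by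
  have hu : 0 ≤ u := (abs_nonneg v).trans h
  have hw : |v / u| ≤ 1 := by
    rw [abs_div, abs_of_nonneg hu]
    exact div_le_one_of_le₀ h hu
  have hv : u * (v / u) = v := mul_div_cancel_of_imp' fun hu₀ =>
    abs_nonpos_iff.1 (h.trans_eq hu₀)
  calc energyDensity n u v = u ^ (2 * n + 1) * energyProfile n (v / u) :=
        energyDensity_eq_pow_mul_energyProfile n u v
    _ ≤ u ^ (2 * n + 1) * (energyProfile n 1 / 2 * (1 + (v / u) ^ 2)) :=
        mul_le_mul_of_nonneg_left (energyProfile_le hn hw) (pow_nonneg hu _)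
    _ = energyProfile n 1 / 2 * u ^ (2 * n - 1) * (u ^ 2 + (u * (v / u)) ^ 2) := by
        rw [show 2 * n + 1 = 2 * n - 1 + 2 by omega, pow_add]
        ring
    _ = energyProfile n 1 / 2 * u ^ (2 * n - 1) * (u ^ 2 + v ^ 2) := by rw [hv]

theorem energyDensity_le_of_le {n : ℕ} (hn : n ≠ 0) {u v M : ℝ} (h : |v| ≤ u) (hM : u ≤ M) :
    energyDensity n u v ≤ energyProfile n 1 / 2 * M ^ (2 * n - 1) * (u ^ 2 + v ^ 2)
      + energyProfile n 1 * ((M ^ (2 * n - 1) * u - u ^ (2 * n)) * v) := by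
  have hu : 0 ≤ u := (abs_nonneg v).trans h
  have hpow : u ^ (2 * n - 1) ≤ M ^ (2 * n - 1) := pow_le_pow_left₀ hu hM _
  have hsquare : 0 ≤ energyProfile n 1 / 2 * (M ^ (2 * n - 1) - u ^ (2 * n - 1)) * (u + v) ^ 2 :=
    mul_nonneg (mul_nonneg (by linarith [two_le_energyProfile_one hn]) (sub_nonneg.2 hpow))
      (sq_nonneg _)
  rw [← pow_sub_one_mul (by omega : 2 * n ≠ 0) u]
  linarith [energyDensity_le hn h]

theorem exists_abs_energyDensity_le (n : ℕ) :
    ∃ D, 0 ≤ D ∧ ∀ u v : ℝ, |v| ≤ u → |energyDensity n u v| ≤ D * u ^ (2 * n + 1) := by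
  have hcont : Continuous (energyProfile n) :=
    continuous_iff_continuousAt.2 fun w => (hasDerivAt_energyProfile n w).continuousAt
  obtain ⟨D, hD⟩ := (isCompact_Icc (a := -1) (b := (1 : ℝ))).exists_bound_of_continuousOn
    hcont.continuousOn
  refine ⟨D, (norm_nonneg _).trans (hD 0 (by norm_num)), fun u v h => ?_⟩
  have hu : 0 ≤ u := (abs_nonneg v).trans h
  have hw : |v / u| ≤ 1 := by
    rw [abs_div, abs_of_nonneg hu]
    exact div_le_one_of_le₀ h hu
  rw [energyDensity_eq_pow_mul_energyProfile, abs_mul, abs_of_nonneg (pow_nonneg hu _), mul_comm]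
  exact mul_le_mul_of_nonneg_right (hD _ (abs_le.1 hw)) (pow_nonneg hu _)

theorem integral_add_two_mul_le_of_hasDerivAt {g h p p' : ℝ → ℝ} {ξ : ℝ} (hg : Integrable g)
    (hh : Integrable h) (hp : ∀ x, HasDerivAt p (p' x) x) (hp' : Integrable p')
    (hlim : Tendsto p (cocompact ℝ) (𝓝 0)) (hleft : ∀ x ≤ ξ, g x ≤ h x - p' x)
    (hright : ∀ x > ξ, g x ≤ h x + p' x) :
    (∫ x, g x) + 2 * p ξ ≤ ∫ x, h x := by
  have hIic : ∫ x in Iic ξ, p' x = p ξ := by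
    rw [integral_Iic_of_hasDerivAt_of_tendsto' (fun x _ => hp x) hp'.integrableOn
      (hlim.mono_left atBot_le_cocompact), sub_zero]
  have hIoi : ∫ x in Ioi ξ, p' x = -p ξ := by
    rw [integral_Ioi_of_hasDerivAt_of_tendsto' (fun x _ => hp x) hp'.integrableOn
      (hlim.mono_left atTop_le_cocompact), zero_sub]
  have hle_left : ∫ x in Iic ξ, g x ≤ (∫ x in Iic ξ, h x) - p ξ := by
    rw [← hIic, ← integral_sub hh.integrableOn hp'.integrableOn]
    exact setIntegral_mono_on hg.integrableOn (hh.sub hp').integrableOn measurableSet_Iic hleft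
  have hle_right : ∫ x in Ioi ξ, g x ≤ (∫ x in Ioi ξ, h x) - p ξ := by
    rw [sub_eq_add_neg, ← hIoi, ← integral_add hh.integrableOn hp'.integrableOn]
    exact setIntegral_mono_on hg.integrableOn (hh.add hp').integrableOn measurableSet_Ioi hright
  rw [← intervalIntegral.integral_Iic_add_Ioi hg.integrableOn hg.integrableOn (b := ξ),
    ← intervalIntegral.integral_Iic_add_Ioi hh.integrableOn hh.integrableOn (b := ξ)]
  linarith

/-- An antiderivative in `z` of the weight `M^(2n-1) z - z^(2n)`; along `z = f x` it collects the
boundary term produced at a maximum `M` of `f`. -/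
def boundaryPotential (n : ℕ) (M z : ℝ) : ℝ :=
  M ^ (2 * n - 1) * (z ^ 2 / 2) - z ^ (2 * n + 1) / (2 * (n : ℝ) + 1)

theorem hasDerivAt_boundaryPotential_comp {f : ℝ → ℝ} {f' x : ℝ} (hf : HasDerivAt f f' x)
    (n : ℕ) (M : ℝ) :
    HasDerivAt (fun x => boundaryPotential n M (f x))
      ((M ^ (2 * n - 1) * f x - f x ^ (2 * n)) * f') x := by
  convert! (((hf.fun_pow 2).div_const 2).const_mul (M ^ (2 * n - 1))).fun_sub
    ((hf.fun_pow (2 * n + 1)).div_const (2 * (n : ℝ) + 1)) using 1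
  push_cast
  field_simp

theorem tendsto_boundaryPotential_comp {α : Type*} {l : Filter α} {f : α → ℝ}
    (hf : Tendsto f l (𝓝 0)) (n : ℕ) (M : ℝ) :
    Tendsto (fun x => boundaryPotential n M (f x)) l (𝓝 0) := by
  have hcont : Continuous (boundaryPotential n M) := by
    unfold boundaryPotential
    fun_prop
  have hzero : boundaryPotential n M 0 = 0 := by simp [boundaryPotential]
  exact hzero ▸ (hcont.tendsto 0).comp hf

theorem two_mul_boundaryPotential_self {n : ℕ} (hn : n ≠ 0) (M : ℝ) :
    2 * boundaryPotential n M M = (2 * (n : ℝ) - 1) / (2 * (n : ℝ) + 1) * M ^ (2 * n + 1) := by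
  rw [boundaryPotential, show 2 * n + 1 = 2 * n - 1 + 2 by omega, pow_add]
  field_simp
  ring

section Maximum

variable {f : ℝ → ℝ} {M : ℝ}

theorem integrable_deriv_sq_of_abs_deriv_le (hf : ContDiff ℝ 1 f) (hdom : ∀ x, |deriv f x| ≤ f x)
    (hint : Integrable fun x => f x ^ 2) : Integrable fun x => deriv f x ^ 2 := by
  refine hint.mono' (hf.continuous_deriv_one.pow 2).aestronglyMeasurable (.of_forall fun x => ?_)
  rw [norm_eq_abs, abs_sq]
  exact sq_le_sq' (neg_le_of_abs_le (hdom x)) (le_of_abs_le (hdom x))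

theorem integrable_energyDensity {n : ℕ} (hn : n ≠ 0) (hf : ContDiff ℝ 1 f)
    (hdom : ∀ x, |deriv f x| ≤ f x) (hM : ∀ x, f x ≤ M) (hint : Integrable fun x => f x ^ 2) :
    Integrable fun x => energyDensity n (f x) (deriv f x) := by
  obtain ⟨D, hD, hbound⟩ := exists_abs_energyDensity_le n
  refine (hint.const_mul (D * M ^ (2 * n - 1))).mono' ((continuous_energyDensity n).comp
    (hf.continuous.prodMk hf.continuous_deriv_one)).aestronglyMeasurable (.of_forall fun x => ?_)
  have hfx : 0 ≤ f x := (abs_nonneg _).trans (hdom x)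
  calc |energyDensity n (f x) (deriv f x)| ≤ D * f x ^ (2 * n + 1) := hbound _ _ (hdom x)
    _ = D * f x ^ (2 * n - 1) * f x ^ 2 := by
      rw [mul_assoc, ← pow_add]
      congr 2
      omega
    _ ≤ D * M ^ (2 * n - 1) * f x ^ 2 := by gcongr; exact hM x

theorem integrable_pow_mul_sub_pow_mul_deriv {n : ℕ} (hn : n ≠ 0) (hf : ContDiff ℝ 1 f)
    (hdom : ∀ x, |deriv f x| ≤ f x) (hM : ∀ x, f x ≤ M) (hint : Integrable fun x => f x ^ 2) :
    Integrable fun x => (M ^ (2 * n - 1) * f x - f x ^ (2 * n)) * deriv f x := by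
  have hcont : Continuous fun x => (M ^ (2 * n - 1) * f x - f x ^ (2 * n)) * deriv f x :=
    ((hf.continuous.const_mul _).sub (hf.continuous.pow _)).mul hf.continuous_deriv_one
  refine (hint.const_mul (M ^ (2 * n - 1))).mono' hcont.aestronglyMeasurable
    (.of_forall fun x => ?_)
  have hfx : 0 ≤ f x := (abs_nonneg _).trans (hdom x)
  have hpow : f x ^ (2 * n - 1) ≤ M ^ (2 * n - 1) := pow_le_pow_left₀ hfx (hM x) _
  rw [← pow_sub_one_mul (by omega : 2 * n ≠ 0) (f x), ← sub_mul, norm_mul, norm_mul, norm_eq_abs,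
    norm_eq_abs, norm_eq_abs, abs_of_nonneg hfx, abs_of_nonneg (sub_nonneg.2 hpow), mul_assoc,
    pow_two]
  exact mul_le_mul (sub_le_self _ (pow_nonneg hfx _))
    (mul_le_mul_of_nonneg_left (hdom x) hfx) (by positivity) ((pow_nonneg hfx _).trans hpow)

theorem max_inequality {n : ℕ} (hn : n ≠ 0) (hf : ContDiff ℝ 1 f)
    (hdom : ∀ x, |deriv f x| ≤ f x) (hint : Integrable fun x => f x ^ 2)
    (hlim : Tendsto f (cocompact ℝ) (𝓝 0)) {ξ : ℝ} (hξ : ∀ x, f x ≤ f ξ) :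
    (2 * (n : ℝ) - 1) * (2 - c₁ n) / (2 * (n : ℝ) + 1) * f ξ ^ (2 * n + 1)
        - (2 - c₁ n) / 2 * f ξ ^ (2 * n - 1) * H₁ f + H₂ n f ≤ 0 := by
  have hderiv (x : ℝ) := (hasDerivAt_boundaryPotential_comp (hf.differentiable_one x).hasDerivAt n
    (f ξ)).const_mul (energyProfile n 1)
  have hpotential : Tendsto (fun x => energyProfile n 1 * boundaryPotential n (f ξ) (f x))
      (cocompact ℝ) (𝓝 0) := by
    simpa only [mul_zero] using (tendsto_boundaryPotential_comp hlim n (f ξ)).const_mul _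
  have hint_sq := hint.fun_add (integrable_deriv_sq_of_abs_deriv_le hf hdom hint)
  have hright (x : ℝ) := energyDensity_le_of_le hn (hdom x) (hξ x)
  have hleft (x : ℝ) := energyDensity_le_of_le hn ((abs_neg _).trans_le (hdom x)) (hξ x)
  simp only [energyDensity_neg, neg_sq, mul_neg, ← sub_eq_add_neg] at hleft
  have hle := integral_add_two_mul_le_of_hasDerivAt (ξ := ξ)
    (integrable_energyDensity hn hf hdom hξ hint) (hint_sq.const_mul _) hderiv
    ((integrable_pow_mul_sub_pow_mul_deriv hn hf hdom hξ hint).const_mul _) hpotential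
    (fun x _ => hleft x) fun x _ => hright x
  rw [integral_const_mul, ← H₂_eq_integral_energyDensity, ← H₁, mul_left_comm,
    two_mul_boundaryPotential_self hn] at hle
  rw [two_sub_c₁ hn, mul_div_right_comm]
  linarith

end Maximum

end HOCH

end

theorem proposition1p3 (n : ℕ) (hn : 1 ≤ n) (s : ℝ) (hs : 5 / 2 < s)
    (u₀ : ℝ → ℝ) (hu₀ : HOCH.MemHs s u₀) (hm₀ : ∀ x, 0 ≤ HOCH.momentum u₀ x)
    (T : ℝ) (hT : 0 < T) (u : ℝ → ℝ → ℝ) (hu : HOCH.IsStrongSolution n s T u₀ u) :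
    ∀ t ∈ Set.Ico 0 T, ∃ M : ℝ, IsGreatest (Set.range (u t)) M ∧
      (2 * (n : ℝ) - 1) * (2 - HOCH.c₁ n) / (2 * (n : ℝ) + 1) * M ^ (2 * n + 1)
        - (2 - HOCH.c₁ n) / 2 * M ^ (2 * n - 1) * HOCH.H₁ (u t) + HOCH.H₂ n (u t) ≤ 0 := by
  intro t ht
  have hcont : Continuous (u t) := hu.continuous t ht
  have hdom : ∀ x, |deriv (u t) x| ≤ u t x := hu.abs_deriv_le hs hm₀ ht
  obtain ⟨U, -, hU⟩ := hu.regularity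
  have hlim : Filter.Tendsto (u t) (Filter.cocompact ℝ) (nhds 0) :=
    (hU t ht).tendsto_iterate_deriv (k := 0) hcont (by norm_num; linarith)
  obtain ⟨ξ, hξ⟩ := HOCH.exists_forall_le_of_tendsto_cocompact hcont
    (fun x => (abs_nonneg _).trans (hdom x)) hlim
  exact ⟨u t ξ, ⟨⟨ξ, rfl⟩, Set.forall_mem_range.2 hξ⟩,
    HOCH.max_inequality (by omega) ((hu.contDiff hs ht).of_le one_le_two) hdom
      (hU t ht).integrable_sq hlim hξ⟩
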